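/- **Conventions.** Let $\mathbb{X}$ be a category with finite products and zero morphisms. For an object $X$ let $\iota_1=\langle 1_X,0\rangle$, $\iota_2=\langle 0,1_X\rangle$ and $\Delta_X=\langle 1_X,1_X\rangle\colon X\to X\times X$. The category $\mathbb{X}$ is *strongly unital* if it has finite limits and, for every object $X$, the morphisms $\iota_1$ and $\Delta_X$ are jointly extremally epic: every monomorphism $m\colon M\to X\times X$ through which both $\iota_1$ and $\Delta_X$ factor is an isomorphism. Let $\mathsf{AbG}[\mathbb{X}]$ be the category of abelian group objects and homomorphisms of $\mathbb{X}$, and $\mathcal{U}\colon\mathsf{AbG}[\mathbb{X}]\to\mathbb{X}$ the forgetful functor. An *additive assignment* on $\mathbb{X}$ is a finite product preserving endofunctor $\mathcal{L}$ with an abelian group structure $(+_X,0_X,-_X)$ on each $\mathcal{L}(X)$, natural in $X$, and a natural isomorphism $\nu_X\colon\mathcal{L}\mathcal{L}(X)\to\mathcal{L}(X)$ of abelian group objects such that $\nu_{\mathcal{L}(X)}=\mathcal{L}(\nu_X)$. Write $\omega_{X,Y}\colon\mathcal{L}(X\times Y)\cong\mathcal{L}(X)\times\mathcal{L}(Y)$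 for the canonical isomorphism, and $0$ also for the zero morphism $Y\to *\xrightarrow{0_X}\mathcal{L}(X)$. Associated with $\mathcal{L}$ is the following data $\mathbb{T}_{\mathcal{L}}$, where generalized elements are used: - the tangent bundle functor $\mathcal{T}(X)=X\times\mathcal{L}(X)$, $\mathcal{T}(f)=f\times\mathcal{L}(f)$, with projection $\mathsf{p}_X(x,a)=x$; - $\mathcal{T}_2(X)=X\times(\mathcal{L}(X)\times\mathcal{L}(X))$, which is the pullback of $\mathsf{p}_X$ along itself, with sum $\mathsf{s}_X(x,(a,b))=(x,a+b)$, zero $\mathsf{z}_X(x)=(x,0)$ and negative $\mathsf{n}_X(x,a)=(x,-a)$; - identifying $\mathcal{T}\mathcal{T}(X)$ with $(X\times\mathcal{L}(X))\times(\mathcal{L}(X)\times\mathcal{L}\mathcal{L}(X))$ by $\omega_{X,\mathcal{L}(X)}$, the vertical lift $\ell_X(x,a)=((x,0),(0,\nu_X^{-1}(a)))$ and the canonical flip $\mathsf{c}_X((x,a),(b,d))=((x,b),(a,d))$. A *tangent category* is a category with a tangent structure $(\mathcal{T},\mathsf{p},\mathsf{s},\mathsf{z},\ell,\mathsf{c})$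 in the sense of Cockett and Cruttwell, with fibres of the tangent bundles commutative monoids; it is *Rosický* if it moreover has a negative $\mathsf{n}$, making these fibres abelian groups, and *cartesian* if the category has finite products and $\mathcal{T}$ preserves them. An *additive bundle* over $X$ is a morphism $q\colon E\to X$ such that the pullback $E_n$ of $n$ copies of $q$ exists for all $n$, together with morphisms $\bullet\colon E_2\to E$ and $e\colon X\to E$ over $X$ making $q$ a commutative monoid over $X$. A *differential bundle* over $X$ in a tangent category is an additive bundle $(q\colon E\to X,\bullet,e)$ such that each $\mathcal{T}^m$ preserves the pullbacks $E_n$, with a lift $\lambda\colon E\to\mathcal{T}(E)$ such that $(\lambda,\mathsf{z}_X)$ is an additive bundle morphism to $\mathcal{T}(q)$, $(\lambda,e)$ is an additive bundle morphism to $\mathsf{p}_E$, $\mathcal{T}(\lambda)\circ\lambda=\ell_E\circ\lambda$, and the square $$\mathcal{T}(q)\circ\bigl(\mathcal{T}(\bullet)\circ\langle\lambda\circ\rho_1,\mathsf{z}_E\circ\rho_2\rangle\bigr)=\mathsf{z}_X\circ(q\circ\rho_1)\colon E_2\to\mathcal{T}(X),$$ with $\rho_1,\rho_2\colon E_2\to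 E$ the projections, is a pullback preserved by each $\mathcal{T}^m$. A *linear bundle morphism* from $(q\colon E\to X,\lambda)$ to $(q'\colon E'\to X',\lambda')$ is a pair $(f\colon E\to E',\,g\colon X\to X')$ with $q'\circ f=g\circ q$ and $\lambda'\circ f=\mathcal{T}(f)\circ\lambda$. Let $\mathsf{DBUN}$ be the category of all differential bundles and linear bundle morphisms, and $\mathsf{DBUN}_X$ the category of differential bundles over $X$ and linear bundle morphisms with $g=1_X$. **Theorem.** Let $\mathbb{X}$ be a finitely cocomplete, regular, strongly unital category. Then the forgetful functor $\mathcal{U}\colon\mathsf{AbG}[\mathbb{X}]\to\mathbb{X}$ has a left adjoint $\mathrm{Ab}$ (abelianization). Let $\mathrm{Ab}$ be any left adjoint of $\mathcal{U}$, with unit $\eta$ and counit $\varepsilon$. For every object $X$, the morphism $X\times X\to\mathrm{Ab}(X)$, $(x,y)\mapsto\eta_X(x)+\eta_X(y)$, is a coequalizer of $\iota_1,\iota_2\colon X\to X\times X$. Moreover: 1. The endofunctor $\mathcal{L}_{\mathrm{Ab}}=\mathcal{U}\circ\mathrm{Ab}$, with the group structures of the objects $\mathrm{Ab}(X)$ and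 with $\nu_X=\varepsilon_{\mathrm{Ab}(X)}$, is an additive assignment on $\mathbb{X}$. 2. $(\mathbb{X},\mathbb{T}_{\mathcal{L}_{\mathrm{Ab}}})$ is a cartesian Rosický tangent category, with tangent bundle functor $\mathcal{T}(X)=X\times\mathrm{Ab}(X)$. 3. There is an equivalence of categories $\mathsf{DBUN}[(\mathbb{X},\mathbb{T}_{\mathcal{L}_{\mathrm{Ab}}})]\simeq\mathbb{X}\times\mathsf{AbG}[\mathbb{X}]$. 4. For every object $X$ of $\mathbb{X}$ there is an equivalence of categories $\mathsf{DBUN}[(\mathbb{X},\mathbb{T}_{\mathcal{L}_{\mathrm{Ab}}})]_X\simeq\mathsf{AbG}[\mathbb{X}]$. -/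

import Mathlib

open CategoryTheory Limits MonoidalCategory CartesianMonoidalCategory MonObj GrpObj

universe v u

noncomputable section

namespace TangentCat

/-! ### Bundles and additive bundles -/

section Bundles

variable {C : Type u} [Category.{v} C]

/-- The diagram consisting of `n` copies of a morphism `q`; its limit is the pullback of `n` copies
of `q` (for `n = 0` this is the codomain of `q`). -/
abbrev powerDiagram {E X : C} (q : E ⟶ X) (n : ℕ) : WidePullbackShape (Fin n) ⥤ C :=
  WidePullbackShape.wideCospan X (fun _ : Fin n => E) (fun _ => q)

/-- `q` is a bundle: for every `n`, the pullback of `n` copies of `q` exists. -/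
def IsBundle {E X : C} (q : E ⟶ X) : Prop :=
  ∀ n : ℕ, HasLimit (powerDiagram q n)

/-- The functor `F` preserves, for every `n`, the pullback of `n` copies of `q`. -/
def PreservesPowers (F : C ⥤ C) {E X : C} (q : E ⟶ X) : Prop :=
  ∀ n : ℕ, PreservesLimit (powerDiagram q n) F

/-- The iterates `F ^ m` of an endofunctor. -/
def iter (F : C ⥤ C) : ℕ → (C ⥤ C)
  | 0 => 𝟭 C
  | m + 1 => iter F m ⋙ F

theorem PreservesPowers.of_iter_one {F : C ⥤ C} {E X : C} {q : E ⟶ X}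
    (h : PreservesPowers (iter F 1) q) : PreservesPowers F q := h

theorem PreservesPowers.map_isPullback {F : C ⥤ C} {E X P : C} {q : E ⟶ X}
    (h : PreservesPowers F q) {ρ₁ ρ₂ : P ⟶ E} (hP : IsPullback ρ₁ ρ₂ q q) :
    IsPullback (F.map ρ₁) (F.map ρ₂) (F.map q) (F.map q) := by
  have := h 2
  let c : WidePullbackCone (fun _ : Fin 2 => q) :=
    WidePullbackCone.mk (ρ₁ ≫ q) (Fin.cases ρ₁ (fun _ => ρ₂))
      (fun i => by
        refine Fin.cases rfl (fun _ => ?_) i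
        exact hP.w.symm)
  have hc : IsLimit c := WidePullbackCone.IsLimit.mk c
    (fun t => hP.lift (t.π 0) (t.π 1) (by rw [t.condition 0, t.condition 1]))
    (fun t => by
      change hP.lift _ _ _ ≫ ρ₁ ≫ q = _
      rw [← Category.assoc, hP.lift_fst, t.condition 0])
    (fun t i => by
      fin_cases i
      · exact hP.lift_fst _ _ _
      · exact hP.lift_snd _ _ _)
    (fun t m _ hm => hP.hom_ext ((hm 0).trans (hP.lift_fst _ _ _).symm)
      ((hm 1).trans (hP.lift_snd _ _ _).symm))
  have hF := isLimitOfPreserves F hc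
  refine IsPullback.of_isLimit' ⟨by rw [← F.map_comp, ← F.map_comp, hP.w]⟩ ?_
  let k : ∀ s : PullbackCone (F.map q) (F.map q), Cone (powerDiagram q 2 ⋙ F) := fun s =>
    WidePullbackShape.mkCone (F := powerDiagram q 2 ⋙ F) (s.fst ≫ F.map q)
      (Fin.cases s.fst (fun _ => s.snd)) (fun i => by
        refine Fin.cases rfl (fun _ => ?_) i
        exact s.condition.symm)
  refine PullbackCone.IsLimit.mk _ (fun s => hF.lift (k s)) (fun s => ?_) (fun s => ?_)
    (fun s m h₁ h₂ => ?_)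
  · exact hF.fac (k s) (some 0)
  · exact hF.fac (k s) (some 1)
  · refine hF.uniq (k s) m (fun j => ?_)
    rcases j with _ | j
    · change m ≫ F.map (ρ₁ ≫ q) = s.fst ≫ F.map q
      rw [F.map_comp, ← Category.assoc, h₁]
    · fin_cases j
      · exact h₁
      · exact h₂

/-- The data of an additive bundle over `X`, without the axioms: a projection `q : E ⟶ X`, a pullback
`E₂` of two copies of `q`, a sum `E₂ ⟶ E` and a zero `X ⟶ E`. -/
structure BundleData (X : C) where
  E : C
  q : E ⟶ X
  E₂ : C
  ρ₁ : E₂ ⟶ E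
  ρ₂ : E₂ ⟶ E
  isPullback : IsPullback ρ₁ ρ₂ q q
  sum : E₂ ⟶ E
  zero : X ⟶ E

namespace BundleData

/-- The pairing `⟨a, b⟩ : Z ⟶ E₂`. -/
def pair {X : C} (B : BundleData X) {Z : C} (a b : Z ⟶ B.E) (h : a ≫ B.q = b ≫ B.q) : Z ⟶ B.E₂ :=
  B.isPullback.lift a b h

/-- The axioms of an additive bundle over `X`: a bundle `q` which is a commutative monoid in the slice
over `X`. Associativity is stated on generalized elements of the pullback of three copies of `q`. -/
structure IsAdditive {X : C} (B : BundleData X) : Prop where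
  isBundle : IsBundle B.q
  sum_q : B.sum ≫ B.q = B.ρ₁ ≫ B.q
  zero_q : B.zero ≫ B.q = 𝟙 X
  assoc : ∀ {Z : C} (a b c : Z ⟶ B.E) (hab : a ≫ B.q = b ≫ B.q) (hbc : b ≫ B.q = c ≫ B.q),
    B.pair (B.pair a b hab ≫ B.sum) c
        (by rw [Category.assoc, sum_q, ← Category.assoc, pair, B.isPullback.lift_fst, hab, hbc]) ≫
      B.sum =
    B.pair a (B.pair b c hbc ≫ B.sum)
        (by rw [Category.assoc, sum_q, ← Category.assoc, pair, B.isPullback.lift_fst, hab]) ≫ B.sum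
  zero_sum : B.pair (B.q ≫ B.zero) (𝟙 B.E)
    (by rw [Category.assoc, zero_q, Category.comp_id, Category.id_comp]) ≫ B.sum = 𝟙 B.E
  sum_zero : B.pair (𝟙 B.E) (B.q ≫ B.zero)
    (by rw [Category.assoc, zero_q, Category.comp_id, Category.id_comp]) ≫ B.sum = 𝟙 B.E
  sum_comm : B.pair B.ρ₂ B.ρ₁ B.isPullback.w.symm ≫ B.sum = B.sum

/-- `(f, g)` is an additive bundle morphism. -/
structure IsAdditiveHom {X Y : C} (A : BundleData X) (B : BundleData Y) (f : A.E ⟶ B.E)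
    (g : X ⟶ Y) : Prop where
  comm : f ≫ B.q = A.q ≫ g
  sum : A.sum ≫ f = B.pair (A.ρ₁ ≫ f) (A.ρ₂ ≫ f)
    (by rw [Category.assoc, Category.assoc, comm, ← Category.assoc, A.isPullback.w,
      Category.assoc]) ≫ B.sum
  zero : A.zero ≫ f = g ≫ B.zero

/-- The image of the data of an additive bundle under a functor preserving the pullback powers of its
projection. -/
def map {X : C} (B : BundleData X) (F : C ⥤ C) (h : PreservesPowers F B.q) :
    BundleData (F.obj X) where
  E := F.obj B.E
  q := F.map B.q
  E₂ := F.obj B.E₂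
  ρ₁ := F.map B.ρ₁
  ρ₂ := F.map B.ρ₂
  isPullback := h.map_isPullback B.isPullback
  sum := F.map B.sum
  zero := F.map B.zero

end BundleData

end Bundles

/-! ### Tangent structures -/

section Tangent

/-- The data of a tangent structure, without the axioms: the tangent bundle functor `T`, the
projection `p`, the functor `T₂` of pairs of tangent vectors over the same point (a pullback of two
copies of `p`), the sum `s`, the zero `z`, the vertical lift `l` and the canonical flip `c`. -/
structure TangentData (C : Type u) [Category.{v} C] where
  T : C ⥤ C
  p : T ⟶ 𝟭 C
  T₂ : C ⥤ C
  ρ₁ : T₂ ⟶ T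
  ρ₂ : T₂ ⟶ T
  isPullback : ∀ X : C, IsPullback (ρ₁.app X) (ρ₂.app X) (p.app X) (p.app X)
  s : T₂ ⟶ T
  z : 𝟭 C ⟶ T
  l : T ⟶ T ⋙ T
  c : T ⋙ T ⟶ T ⋙ T

variable {C : Type u} [Category.{v} C]

namespace TangentData

/-- The tangent bundle of `X`, with its sum and zero. -/
def bundle (D : TangentData C) (X : C) : BundleData X where
  E := D.T.obj X
  q := D.p.app X
  E₂ := D.T₂.obj X
  ρ₁ := D.ρ₁.app X
  ρ₂ := D.ρ₂.app X
  isPullback := D.isPullback X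
  sum := D.s.app X
  zero := D.z.app X

/-- For a lift `lam : E ⟶ T E` covering the zero `z : X ⟶ T X`, the morphism
`T(σ) ∘ ⟨lam ∘ ρ₁, z ∘ ρ₂⟩ : E₂ ⟶ T E₂ ⟶ T E`. -/
def liftSum (D : TangentData C) {X : C} (B : BundleData X) (hB : PreservesPowers D.T B.q)
    (lam : B.E ⟶ D.T.obj B.E) (h : lam ≫ D.T.map B.q = B.q ≫ D.z.app X) :
    B.E₂ ⟶ D.T.obj B.E :=
  (B.map D.T hB).pair (B.ρ₁ ≫ lam) (B.ρ₂ ≫ D.z.app B.E) (by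
    have hz : D.z.app B.E ≫ D.T.map B.q = B.q ≫ D.z.app X := (D.z.naturality B.q).symm
    change (B.ρ₁ ≫ lam) ≫ D.T.map B.q = (B.ρ₂ ≫ D.z.app B.E) ≫ D.T.map B.q
    rw [Category.assoc, Category.assoc, h, hz, ← Category.assoc, B.isPullback.w, Category.assoc])
    ≫ D.T.map B.sum

/-- The axioms of a tangent structure. -/
structure IsTangentStructure (D : TangentData C) : Prop where
  additive : ∀ X : C, (D.bundle X).IsAdditive
  preserves : ∀ (m : ℕ) (X : C), PreservesPowers (iter D.T m) (D.p.app X)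
  lift_additive : ∀ X : C, BundleData.IsAdditiveHom (D.bundle X)
    ((D.bundle X).map D.T (preserves 1 X).of_iter_one) (D.l.app X) (D.z.app X)
  lift_lift : ∀ X : C,
    D.l.app X ≫ D.l.app (D.T.obj X) = D.l.app X ≫ D.T.map (D.l.app X)
  lift_universal : ∀ X : C, IsPullback
    (D.liftSum (D.bundle X) (preserves 1 X).of_iter_one (D.l.app X) (lift_additive X).comm)
    (D.ρ₁.app X ≫ D.p.app X) (D.T.map (D.p.app X)) (D.z.app X)
  flip_flip : ∀ X : C, D.c.app X ≫ D.c.app X = 𝟙 _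
  yang_baxter : ∀ X : C,
    D.T.map (D.c.app X) ≫ D.c.app (D.T.obj X) ≫ D.T.map (D.c.app X) =
      D.c.app (D.T.obj X) ≫ D.T.map (D.c.app X) ≫ D.c.app (D.T.obj X)
  flip_additive : ∀ X : C, BundleData.IsAdditiveHom
    ((D.bundle X).map D.T (preserves 1 X).of_iter_one) (D.bundle (D.T.obj X)) (D.c.app X)
    (𝟙 (D.T.obj X))
  lift_flip : ∀ X : C, D.l.app X ≫ D.c.app X = D.l.app X
  flip_lift : ∀ X : C,
    D.l.app (D.T.obj X) ≫ D.T.map (D.c.app X) ≫ D.c.app (D.T.obj X) =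
      D.c.app X ≫ D.T.map (D.l.app X)

end TangentData

/-- The data of a Rosický tangent structure: that of a tangent structure and the negative `n`. -/
structure RosickyTangentData (C : Type u) [Category.{v} C] extends TangentData C where
  n : T ⟶ T

/-- The axioms of a Rosický tangent structure: those of a tangent structure, and the negative makes
each tangent bundle an abelian group bundle. -/
structure RosickyTangentData.IsRosickyTangentStructure (D : RosickyTangentData C) : Prop extends
    D.toTangentData.IsTangentStructure where
  neg_p : ∀ X : C, D.n.app X ≫ D.p.app X = D.p.app X
  sum_neg : ∀ X : C, (D.bundle X).pair (𝟙 (D.T.obj X)) (D.n.app X)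
    ((Category.id_comp _).trans (neg_p X).symm) ≫ D.s.app X = D.p.app X ≫ D.z.app X
  neg_sum : ∀ X : C, (D.bundle X).pair (D.n.app X) (𝟙 (D.T.obj X))
    ((neg_p X).trans (Category.id_comp _).symm) ≫ D.s.app X = D.p.app X ≫ D.z.app X

/-- A cartesian Rosický tangent structure on a category with finite products: the tangent bundle
functor preserves finite products. -/
structure RosickyTangentData.IsCartesianRosicky [CartesianMonoidalCategory C]
    (D : RosickyTangentData C) : Prop extends D.IsRosickyTangentStructure where
  preservesFiniteProducts : PreservesFiniteProducts D.T

/-! ### Differential bundles -/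

/-- A differential bundle over `X`, with lift `lam`. -/
structure DiffBundle (D : TangentData C) (X : C) extends BundleData X where
  additive : toBundleData.IsAdditive
  preserves : ∀ m : ℕ, PreservesPowers (iter D.T m) q
  lam : E ⟶ D.T.obj E
  lam_additive_zero : BundleData.IsAdditiveHom toBundleData
    (toBundleData.map D.T (preserves 1).of_iter_one) lam (D.z.app X)
  lam_additive : BundleData.IsAdditiveHom toBundleData (D.bundle E) lam zero
  lam_lam : lam ≫ D.T.map lam = lam ≫ D.l.app E
  universal : IsPullback
    (D.liftSum toBundleData (preserves 1).of_iter_one lam lam_additive_zero.comm)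
    (ρ₁ ≫ q) (D.T.map q) (D.z.app X)
  preserves_universal : ∀ m : ℕ, IsPullback
    ((iter D.T m).map
      (D.liftSum toBundleData (preserves 1).of_iter_one lam lam_additive_zero.comm))
    ((iter D.T m).map (ρ₁ ≫ q)) ((iter D.T m).map (D.T.map q)) ((iter D.T m).map (D.z.app X))

/-- Linear bundle morphisms over `X`. -/
@[ext]
structure DiffBundle.Hom {D : TangentData C} {X : C} (A B : DiffBundle D X) where
  f : A.E ⟶ B.E
  comm : f ≫ B.q = A.q
  linear : f ≫ B.lam = A.lam ≫ D.T.map f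

/-- The category of differential bundles over `X` and linear bundle morphisms over `X`. -/
instance (D : TangentData C) (X : C) : Category (DiffBundle D X) where
  Hom A B := DiffBundle.Hom A B
  id A := ⟨𝟙 A.E, by simp, by simp⟩
  comp φ ψ := ⟨φ.f ≫ ψ.f, by rw [Category.assoc, ψ.comm, φ.comm], by
    rw [Category.assoc, ψ.linear, ← Category.assoc, φ.linear, Category.assoc, D.T.map_comp]⟩
  id_comp φ := DiffBundle.Hom.ext (Category.id_comp φ.f)
  comp_id φ := DiffBundle.Hom.ext (Category.comp_id φ.f)
  assoc φ ψ χ := DiffBundle.Hom.ext (Category.assoc φ.f ψ.f χ.f)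

/-- A differential bundle, over some object. -/
structure DBun (D : TangentData C) where
  base : C
  bundle : DiffBundle D base

/-- Linear bundle morphisms. -/
@[ext]
structure DBun.Hom {D : TangentData C} (A B : DBun D) where
  f : A.bundle.E ⟶ B.bundle.E
  g : A.base ⟶ B.base
  comm : f ≫ B.bundle.q = A.bundle.q ≫ g
  linear : f ≫ B.bundle.lam = A.bundle.lam ≫ D.T.map f

/-- The category of differential bundles and linear bundle morphisms. -/
instance (D : TangentData C) : Category (DBun D) where
  Hom A B := DBun.Hom A B
  id A := ⟨𝟙 A.bundle.E, 𝟙 A.base, by simp, by simp⟩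
  comp φ ψ := ⟨φ.f ≫ ψ.f, φ.g ≫ ψ.g,
    by rw [Category.assoc, ψ.comm, ← Category.assoc, φ.comm, Category.assoc], by
    rw [Category.assoc, ψ.linear, ← Category.assoc, φ.linear, Category.assoc, D.T.map_comp]⟩
  id_comp φ := DBun.Hom.ext (Category.id_comp φ.f) (Category.id_comp φ.g)
  comp_id φ := DBun.Hom.ext (Category.comp_id φ.f) (Category.comp_id φ.g)
  assoc φ ψ χ := DBun.Hom.ext (Category.assoc φ.f ψ.f χ.f) (Category.assoc φ.g ψ.g χ.g)

end Tangent

/-! ### The tangent structure induced by an additive assignment -/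

section Products

variable {C : Type u} [Category.{v} C] [CartesianMonoidalCategory C]

/-- The product `X ↦ F X × G X` of two endofunctors. -/
def prodFunctor (F G : C ⥤ C) : C ⥤ C where
  obj X := F.obj X ⊗ G.obj X
  map f := F.map f ⊗ₘ G.map f

theorem isPullback_proj (X Y : C) :
    IsPullback (𝟙 X ⊗ₘ fst Y Y) (𝟙 X ⊗ₘ snd Y Y) (fst X Y) (fst X Y) := by
  refine ⟨⟨by simp⟩, ⟨PullbackCone.IsLimit.mk _
    (fun s => lift (s.fst ≫ fst X Y) (lift (s.fst ≫ snd X Y) (s.snd ≫ snd X Y)))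
    (fun s => ?_) (fun s => ?_) (fun s m h₁ h₂ => ?_)⟩⟩
  · ext <;> simp
  · ext <;> simp [s.condition]
  · ext <;> simp [← h₁, ← h₂]

/-- The interchange `(X × Y) × (Z × W) ⟶ (X × Z) × (Y × W)`. -/
def interchange (X Y Z W : C) : (X ⊗ Y) ⊗ (Z ⊗ W) ⟶ (X ⊗ Z) ⊗ (Y ⊗ W) :=
  lift (fst X Y ⊗ₘ fst Z W) (snd X Y ⊗ₘ snd Z W)

theorem interchange_map {X Y Z W X' Y' Z' W' : C} (f : X ⟶ X') (g : Y ⟶ Y') (k : Z ⟶ Z')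
    (l : W ⟶ W') : ((f ⊗ₘ g) ⊗ₘ (k ⊗ₘ l)) ≫ interchange X' Y' Z' W' =
      interchange X Y Z W ≫ ((f ⊗ₘ k) ⊗ₘ (g ⊗ₘ l)) := by
  ext <;> simp [interchange]

end Products

section Assignment

variable {C : Type u} [Category.{v} C] [CartesianMonoidalCategory C] [BraidedCategory C]

/-- The endofunctor `X ↦ L X` of `C` underlying a functor `L` with values in abelian group objects. -/
def underlying (L : C ⥤ CommGrp C) : C ⥤ C := L ⋙ CommGrp.forget C

/-- `(L, ν)` is an additive assignment: a functor `L` which assigns to each object an abelian group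
object, naturally (so that `L` is a functor to the category of abelian group objects), such that the
underlying endofunctor preserves finite products, with a natural isomorphism of abelian group objects
`ν : L (L X) ⟶ L X` such that `ν_{L X} = L (ν_X)`. -/
structure IsAdditiveAssignment (L : C ⥤ CommGrp C) (ν : underlying L ⋙ L ⟶ L) : Prop where
  preservesFiniteProducts : PreservesFiniteProducts (underlying L)
  isIso : IsIso ν
  comm : ∀ X : C, ν.app ((underlying L).obj X) =
    L.map ((CommGrp.forget C).map (ν.app X))

/-- The zero morphism `Y ⟶ L X`. -/
def zeroTo (L : C ⥤ CommGrp C) (Y X : C) : Y ⟶ (underlying L).obj X :=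
  toUnit Y ≫ η[(L.obj X).X]

/-- The addition `L X × L X ⟶ L X`. -/
def addMor (L : C ⥤ CommGrp C) (X : C) :
    (underlying L).obj X ⊗ (underlying L).obj X ⟶ (underlying L).obj X :=
  μ[(L.obj X).X]

/-- The negation `L X ⟶ L X`. -/
def negMor (L : C ⥤ CommGrp C) (X : C) : (underlying L).obj X ⟶ (underlying L).obj X :=
  ι[(L.obj X).X]

theorem zeroTo_map (L : C ⥤ CommGrp C) {Y Y' X X' : C} (g : Y ⟶ Y') (f : X ⟶ X') :
    zeroTo L Y X ≫ (underlying L).map f = g ≫ zeroTo L Y' X' := by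
  have h : η[(L.obj X).X] ≫ (L.map f).hom.hom.hom = η[(L.obj X').X] := IsMonHom.one_hom _
  change (toUnit Y ≫ η[(L.obj X).X]) ≫ (L.map f).hom.hom.hom = g ≫ toUnit Y' ≫ η[(L.obj X').X]
  rw [Category.assoc, h, ← Category.assoc, comp_toUnit]

theorem addMor_map (L : C ⥤ CommGrp C) {X X' : C} (f : X ⟶ X') :
    addMor L X ≫ (underlying L).map f =
      ((underlying L).map f ⊗ₘ (underlying L).map f) ≫ addMor L X' :=
  IsMonHom.mul_hom (L.map f).hom.hom.hom

theorem negMor_map (L : C ⥤ CommGrp C) {X X' : C} (f : X ⟶ X') :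
    negMor L X ≫ (underlying L).map f = (underlying L).map f ≫ negMor L X' :=
  GrpObj.inv_hom (L.map f).hom.hom.hom

namespace IsAdditiveAssignment

variable {L : C ⥤ CommGrp C} {ν : underlying L ⋙ L ⟶ L}

/-- The inverse of `ν_X`, as a morphism `L X ⟶ L (L X)` of `C`. -/
def nuInv (h : IsAdditiveAssignment L ν) (X : C) :
    (underlying L).obj X ⟶ (underlying L).obj ((underlying L).obj X) :=
  haveI := h.isIso
  (CommGrp.forget C).map ((inv ν).app X)

/-- The canonical morphism `ω : L (X × Y) ⟶ L X × L Y`. -/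
def omega (L : C ⥤ CommGrp C) (X Y : C) :
    (underlying L).obj (X ⊗ Y) ⟶ (underlying L).obj X ⊗ (underlying L).obj Y :=
  CartesianMonoidalCategory.prodComparison (underlying L) X Y

/-- The inverse of the canonical morphism `ω`. -/
def omegaInv (h : IsAdditiveAssignment L ν) (X Y : C) :
    (underlying L).obj X ⊗ (underlying L).obj Y ⟶ (underlying L).obj (X ⊗ Y) :=
  haveI := h.preservesFiniteProducts
  inv (CartesianMonoidalCategory.prodComparison (underlying L) X Y)

theorem nuInv_map (h : IsAdditiveAssignment L ν) {X Y : C} (f : X ⟶ Y) :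
    h.nuInv X ≫ (underlying L).map ((underlying L).map f) = (underlying L).map f ≫ h.nuInv Y := by
  have := h.isIso
  exact ((Functor.whiskerRight (inv ν) (CommGrp.forget C)).naturality f).symm

theorem omega_map {X Y X' Y' : C} (f : X ⟶ X') (g : Y ⟶ Y') :
    omega L X Y ≫ ((underlying L).map f ⊗ₘ (underlying L).map g) =
      (underlying L).map (f ⊗ₘ g) ≫ omega L X' Y' :=
  (CartesianMonoidalCategory.prodComparison_natural (underlying L) f g).symm

theorem omegaInv_map (h : IsAdditiveAssignment L ν) {X Y X' Y' : C} (f : X ⟶ X') (g : Y ⟶ Y') :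
    h.omegaInv X Y ≫ (underlying L).map (f ⊗ₘ g) =
      ((underlying L).map f ⊗ₘ (underlying L).map g) ≫ h.omegaInv X' Y' :=
  have := h.preservesFiniteProducts
  CartesianMonoidalCategory.prodComparison_inv_natural (underlying L) f g

/-- The zero section `X ⟶ X × L X`. -/
def zeroSec (L : C ⥤ CommGrp C) (X : C) : X ⟶ X ⊗ (underlying L).obj X :=
  lift (𝟙 X) (zeroTo L X X)

/-- The vertical lift: inserting zeros in the middle components of
`(X × L X) × (L X × L (L X)) ≅ (X × L X) × L (X × L X)`. -/
def vertLift (h : IsAdditiveAssignment L ν) (X : C) :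
    X ⊗ (underlying L).obj X ⟶
      (X ⊗ (underlying L).obj X) ⊗ (underlying L).obj (X ⊗ (underlying L).obj X) :=
  (zeroSec L X ⊗ₘ lift (zeroTo L ((underlying L).obj X) X) (h.nuInv X)) ≫
    (𝟙 (X ⊗ (underlying L).obj X) ⊗ₘ h.omegaInv X ((underlying L).obj X))

/-- The canonical flip: exchanging the middle components of
`(X × L X) × (L X × L (L X)) ≅ (X × L X) × L (X × L X)`. -/
def canFlip (h : IsAdditiveAssignment L ν) (X : C) :
    (X ⊗ (underlying L).obj X) ⊗ (underlying L).obj (X ⊗ (underlying L).obj X) ⟶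
      (X ⊗ (underlying L).obj X) ⊗ (underlying L).obj (X ⊗ (underlying L).obj X) :=
  (𝟙 (X ⊗ (underlying L).obj X) ⊗ₘ omega L X ((underlying L).obj X)) ≫
    interchange X ((underlying L).obj X) ((underlying L).obj X)
      ((underlying L).obj ((underlying L).obj X)) ≫
    (𝟙 (X ⊗ (underlying L).obj X) ⊗ₘ h.omegaInv X ((underlying L).obj X))

theorem zeroSec_map {X Y : C} (f : X ⟶ Y) :
    f ≫ zeroSec L Y = zeroSec L X ≫ (f ⊗ₘ (underlying L).map f) := by
  rw [zeroSec, zeroSec, comp_lift, lift_map, zeroTo_map L f f, Category.comp_id, Category.id_comp]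

theorem vertLift_map (h : IsAdditiveAssignment L ν) {X Y : C} (f : X ⟶ Y) :
    (f ⊗ₘ (underlying L).map f) ≫ h.vertLift Y =
      h.vertLift X ≫ ((f ⊗ₘ (underlying L).map f) ⊗ₘ
        (underlying L).map (f ⊗ₘ (underlying L).map f)) := by
  have h₁ : (underlying L).map f ≫ lift (zeroTo L ((underlying L).obj Y) Y) (h.nuInv Y) =
      lift (zeroTo L ((underlying L).obj X) X) (h.nuInv X) ≫
        ((underlying L).map f ⊗ₘ (underlying L).map ((underlying L).map f)) := by
    rw [comp_lift, lift_map, zeroTo_map L ((underlying L).map f) f, nuInv_map]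
  simp only [vertLift, Category.assoc, tensorHom_comp_tensorHom, Category.comp_id, omegaInv_map, zeroSec_map]
  rw [← Category.assoc, h₁, Category.assoc]

theorem canFlip_map (h : IsAdditiveAssignment L ν) {X Y : C} (f : X ⟶ Y) :
    ((f ⊗ₘ (underlying L).map f) ⊗ₘ (underlying L).map (f ⊗ₘ (underlying L).map f)) ≫
        h.canFlip Y =
      h.canFlip X ≫ ((f ⊗ₘ (underlying L).map f) ⊗ₘ
        (underlying L).map (f ⊗ₘ (underlying L).map f)) := by
  have h₂ : ((f ⊗ₘ (underlying L).map f) ⊗ₘ (underlying L).map (f ⊗ₘ (underlying L).map f)) ≫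
      (𝟙 (Y ⊗ (underlying L).obj Y) ⊗ₘ omega L Y ((underlying L).obj Y)) =
      (𝟙 (X ⊗ (underlying L).obj X) ⊗ₘ omega L X ((underlying L).obj X)) ≫
        ((f ⊗ₘ (underlying L).map f) ⊗ₘ
          ((underlying L).map f ⊗ₘ (underlying L).map ((underlying L).map f))) := by
    rw [tensorHom_comp_tensorHom, tensorHom_comp_tensorHom, omega_map, Category.comp_id,
      Category.id_comp]
  have h₃ : ((f ⊗ₘ (underlying L).map f) ⊗ₘ
        ((underlying L).map f ⊗ₘ (underlying L).map ((underlying L).map f))) ≫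
      (𝟙 (Y ⊗ (underlying L).obj Y) ⊗ₘ h.omegaInv Y ((underlying L).obj Y)) =
      (𝟙 (X ⊗ (underlying L).obj X) ⊗ₘ h.omegaInv X ((underlying L).obj X)) ≫
        ((f ⊗ₘ (underlying L).map f) ⊗ₘ (underlying L).map (f ⊗ₘ (underlying L).map f)) := by
    rw [tensorHom_comp_tensorHom, tensorHom_comp_tensorHom, omegaInv_map, Category.comp_id,
      Category.id_comp]
  rw [canFlip, canFlip, ← Category.assoc, h₂, Category.assoc, Category.assoc, Category.assoc,
    ← h₃, ← Category.assoc (_ ⊗ₘ _) (interchange _ _ _ _), interchange_map, Category.assoc]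

/-- The (data of the) Rosický tangent structure induced by an additive assignment: the tangent bundle
functor is `X ↦ X × L X`, and pairs of tangent vectors over the same point form `X × (L X × L X)`. -/
def tangentData (h : IsAdditiveAssignment L ν) : RosickyTangentData C where
  T := prodFunctor (𝟭 C) (underlying L)
  p :=
    { app := fun X => fst X ((underlying L).obj X)
      naturality := fun _ _ _ => tensorHom_fst _ _ }
  T₂ := prodFunctor (𝟭 C) (prodFunctor (underlying L) (underlying L))
  ρ₁ :=
    { app := fun X => 𝟙 X ⊗ₘ fst ((underlying L).obj X) ((underlying L).obj X)
      naturality := fun X Y f => by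
        simp only [prodFunctor, Functor.id_obj, Functor.id_map, tensorHom_comp_tensorHom,
          tensorHom_fst, Category.id_comp, Category.comp_id] }
  ρ₂ :=
    { app := fun X => 𝟙 X ⊗ₘ snd ((underlying L).obj X) ((underlying L).obj X)
      naturality := fun X Y f => by
        simp only [prodFunctor, Functor.id_obj, Functor.id_map, tensorHom_comp_tensorHom,
          tensorHom_snd, Category.id_comp, Category.comp_id] }
  isPullback := fun X => isPullback_proj X ((underlying L).obj X)
  s :=
    { app := fun X => 𝟙 X ⊗ₘ addMor L X
      naturality := fun X Y f => by
        simp only [prodFunctor, Functor.id_obj, Functor.id_map, tensorHom_comp_tensorHom,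
          addMor_map, Category.id_comp, Category.comp_id] }
  z :=
    { app := fun X => zeroSec L X
      naturality := fun _ _ f => zeroSec_map f }
  l :=
    { app := fun X => h.vertLift X
      naturality := fun _ _ f => h.vertLift_map f }
  c :=
    { app := fun X => h.canFlip X
      naturality := fun _ _ f => h.canFlip_map f }
  n :=
    { app := fun X => 𝟙 X ⊗ₘ negMor L X
      naturality := fun X Y f => by
        simp only [prodFunctor, Functor.id_obj, Functor.id_map, tensorHom_comp_tensorHom,
          negMor_map, Category.id_comp, Category.comp_id] }

end IsAdditiveAssignment

/-! ### Strongly unital categories and abelianization -/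

/-- The quasi-injection `ι₁ = ⟨1, 0⟩ : X ⟶ X × X`. -/
def quasiInj₁ [HasZeroMorphisms C] (X : C) : X ⟶ X ⊗ X := lift (𝟙 X) 0

/-- The quasi-injection `ι₂ = ⟨0, 1⟩ : X ⟶ X × X`. -/
def quasiInj₂ [HasZeroMorphisms C] (X : C) : X ⟶ X ⊗ X := lift 0 (𝟙 X)

/-- A strongly unital category: a category with finite limits and zero morphisms such that, for each
object `X`, the quasi-injection `ι₁ : X ⟶ X × X` and the diagonal of `X` are jointly strongly
(equivalently, extremally) epic. -/
class StronglyUnital (C : Type u) [Category.{v} C] [CartesianMonoidalCategory C]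
    [HasZeroMorphisms C] : Prop extends HasFiniteLimits C where
  isIso_of_factors : ∀ {X M : C} (m : M ⟶ X ⊗ X) [Mono m] (f g : X ⟶ M),
    f ≫ m = quasiInj₁ X → g ≫ m = lift (𝟙 X) (𝟙 X) → IsIso m

/-- The multiplication `Ab (Ab X) ⟶ Ab X` given by the counit of an adjunction `Ab ⊣ U`, where `U` is
the forgetful functor from abelian group objects. -/
def abNu {Ab : C ⥤ CommGrp C} (adj : Ab ⊣ CommGrp.forget C) : underlying Ab ⋙ Ab ⟶ Ab where
  app X := adj.counit.app (Ab.obj X)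
  naturality _ _ f := adj.counit.naturality (Ab.map f)

/-- The morphism `(x, y) ↦ η x + η y : X × X ⟶ Ab X`, with `η : X ⟶ Ab X` the unit of an adjunction
`Ab ⊣ U`. -/
def abQuot {Ab : C ⥤ CommGrp C} (adj : Ab ⊣ CommGrp.forget C) (X : C) :
    X ⊗ X ⟶ (underlying Ab).obj X :=
  (adj.unit.app X ⊗ₘ adj.unit.app X) ≫ addMor Ab X

end Assignment

end TangentCat

end

/-! In a strongly unital category the two axes of a product are jointly extremally epic
(`isIso_of_factors_inl_inr`), so a morphism out of a product is determined by its restrictions to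
the axes (`prod_hom_ext`). A unital multiplication is therefore automatically commutative and
associative, and every morphism preserves it. The diagonal condition gives more: cancellation
(`UnitalMul.cancel_right`), which makes the shear map (a, b) ↦ (a + b, b) invertible and supplies
negatives. Being an abelian group object is thus a property, and these objects form a full
subcategory.

The coequalizer of the two axes of X × X carries such a multiplication: the map from X to it is an
extremal epimorphism, regularity makes the square of this map a regular epimorphism, and the
quotient map descends along it (`exists_abMul`). This is the reflection of X. Any left adjoint
agrees with it through `abObjIso`, so its unit η is epic in the ambient category. Writing L for the
underlying endofunctor of the left adjoint, it follows that L is additive and preserves finite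
products, and that the inverse of ν is η (`nuInv_eq`).

With T(X) = X × L(X), the object TT(X) has four coordinates, and the flip axioms are comparisons of
coordinates that use only naturality of η and L(η) = ηL. The bundle and lift axioms are proved for
every trivial bundle X × A ⟶ X; the tangent bundle is the case A = L(X).

Conversely, every differential bundle q : E ⟶ X is trivial. The universality of its lift, tested on
zero vectors of E paired with elements of K = ker L(q), identifies E with X × K
(`DiffBundle.isIso_triv`). As η is invertible at abelian group objects, a linear morphism of trivial
bundles is a product g × f (`eq_tensorHom_of_linear`), and f is a homomorphism for free. Hence the
trivial bundle functors are equivalences. -/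

noncomputable section

set_option linter.unusedSectionVars false

namespace TangentCat

/-! ### Unital multiplications in strongly unital categories -/

section Unital

variable {C : Type u} [Category.{v} C] [CartesianMonoidalCategory C] [HasZeroMorphisms C]

/-- The injection `⟨1, 0⟩ : X ⟶ X × Y`. -/
def inl (X Y : C) : X ⟶ X ⊗ Y := lift (𝟙 X) 0

/-- The injection `⟨0, 1⟩ : Y ⟶ X × Y`. -/
def inr (X Y : C) : Y ⟶ X ⊗ Y := lift 0 (𝟙 Y)

@[simp]
theorem inl_fst (X Y : C) : inl X Y ≫ fst X Y = 𝟙 X := lift_fst _ _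

@[simp]
theorem inl_fst_assoc (X Y : C) {W : C} (k : X ⟶ W) :
    inl X Y ≫ fst X Y ≫ k = k := by
  simpa only [Category.assoc, Category.id_comp] using inl_fst X Y =≫ k

@[simp]
theorem inl_snd (X Y : C) : inl X Y ≫ snd X Y = 0 := lift_snd _ _

@[simp]
theorem inl_snd_assoc (X Y : C) {W : C} (k : Y ⟶ W) :
    inl X Y ≫ snd X Y ≫ k = 0 ≫ k := by
  simpa only [Category.assoc, Category.id_comp] using inl_snd X Y =≫ k

@[simp]
theorem inr_fst (X Y : C) : inr X Y ≫ fst X Y = 0 := lift_fst _ _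

@[simp]
theorem inr_fst_assoc (X Y : C) {W : C} (k : X ⟶ W) :
    inr X Y ≫ fst X Y ≫ k = 0 ≫ k := by
  simpa only [Category.assoc, Category.id_comp] using inr_fst X Y =≫ k

@[simp]
theorem inr_snd (X Y : C) : inr X Y ≫ snd X Y = 𝟙 Y := lift_snd _ _

@[simp]
theorem inr_snd_assoc (X Y : C) {W : C} (k : Y ⟶ W) :
    inr X Y ≫ snd X Y ≫ k = k := by
  simpa only [Category.assoc, Category.id_comp] using inr_snd X Y =≫ k

theorem toUnit_comp {X Y : C} (f : 𝟙_ C ⟶ X) : toUnit Y ≫ f = 0 := by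
  rw [toUnit_unique (toUnit Y) 0, zero_comp]

/-- The terminal object is a zero object, so the unit of a monoid object is forced to be zero. -/
theorem hom_from_unit {X : C} (f : 𝟙_ C ⟶ X) : f = 0 := by
  rw [← toUnit_comp f, toUnit_unit, Category.id_comp]

variable [StronglyUnital C]

/-- In a strongly unital category, `⟨1, 0⟩` and the diagonal are jointly epic. -/
theorem hom_ext_diag {X Z : C} {f g : X ⊗ X ⟶ Z} (h₁ : inl X X ≫ f = inl X X ≫ g)
    (h₂ : lift (𝟙 X) (𝟙 X) ≫ f = lift (𝟙 X) (𝟙 X) ≫ g) : f = g := by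
  have := StronglyUnital.isIso_of_factors (equalizer.ι f g) (equalizer.lift _ h₁)
    (equalizer.lift _ h₂) (equalizer.lift_ι _ _) (equalizer.lift_ι _ _)
  exact eq_of_epi_equalizer

/-- A strongly unital category is unital: `⟨1, 0⟩` and `⟨0, 1⟩` are jointly extremally epic. -/
theorem isIso_of_factors_inl_inr {X Y M : C} (m : M ⟶ X ⊗ Y) [Mono m] (f : X ⟶ M) (g : Y ⟶ M)
    (hf : f ≫ m = inl X Y) (hg : g ≫ m = inr X Y) : IsIso m := by
  -- In elements, `r` takes the first coordinate of one point of M and the second coordinate of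
  -- another. Both its restriction to the first axis and its restriction to the diagonal land in M,
  -- so the pullback of `m` along `r` is everything and `r` factors through `m`. Evaluating `r` at
  -- (f x, g y) shows that (x, y) lies in M.
  let r : M ⊗ M ⟶ X ⊗ Y := (m ≫ fst X Y) ⊗ₘ (m ≫ snd X Y)
  have h₁ : quasiInj₁ M ≫ r = (m ≫ fst X Y ≫ f) ≫ m := by
    simp only [Category.assoc, hf]
    ext <;> simp [r, quasiInj₁]
  have h₂ : lift (𝟙 M) (𝟙 M) ≫ r = 𝟙 M ≫ m := by
    ext <;> simp [r]
  have := StronglyUnital.isIso_of_factors (pullback.fst r m) (pullback.lift _ _ h₁)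
    (pullback.lift _ _ h₂) (pullback.lift_fst _ _ _) (pullback.lift_fst _ _ _)
  have hr : lift (fst X Y ≫ f) (snd X Y ≫ g) ≫ r = 𝟙 (X ⊗ Y) := by
    ext <;> simp [r, reassoc_of% hf, reassoc_of% hg]
  let s : X ⊗ Y ⟶ M :=
    lift (fst X Y ≫ f) (snd X Y ≫ g) ≫ inv (pullback.fst r m) ≫ pullback.snd r m
  have hs : s ≫ m = 𝟙 (X ⊗ Y) := by
    simp only [s, Category.assoc, ← pullback.condition, IsIso.inv_hom_id_assoc, hr]
  exact ⟨s, by rw [← cancel_mono m, Category.assoc, hs, Category.comp_id, Category.id_comp], hs⟩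

theorem prod_hom_ext {X Y Z : C} {f g : X ⊗ Y ⟶ Z} (h₁ : inl X Y ≫ f = inl X Y ≫ g)
    (h₂ : inr X Y ≫ f = inr X Y ≫ g) : f = g := by
  have := isIso_of_factors_inl_inr (equalizer.ι f g) (equalizer.lift _ h₁)
    (equalizer.lift _ h₂) (equalizer.lift_ι _ _) (equalizer.lift_ι _ _)
  exact eq_of_epi_equalizer

/-- A unital magma structure on an object. -/
structure UnitalMul (A : C) where
  mul : A ⊗ A ⟶ A
  inl_mul : inl A A ≫ mul = 𝟙 A
  inr_mul : inr A A ≫ mul = 𝟙 A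

namespace UnitalMul

variable {A B : C} (m : UnitalMul A)

theorem lift_zero_mul {Z : C} (f : Z ⟶ A) : lift 0 f ≫ m.mul = f := by
  have : lift 0 f = f ≫ inr A A := by ext <;> simp
  rw [this, Category.assoc, m.inr_mul, Category.comp_id]

theorem lift_mul_zero {Z : C} (f : Z ⟶ A) : lift f 0 ≫ m.mul = f := by
  have : lift f 0 = f ≫ inl A A := by ext <;> simp
  rw [this, Category.assoc, m.inl_mul, Category.comp_id]

/-- Both sides restrict to `f` on each axis. With `f` an identity this also shows that an object has
at most one unital multiplication. -/
theorem mul_hom (m' : UnitalMul B) (f : A ⟶ B) : m.mul ≫ f = (f ⊗ₘ f) ≫ m'.mul := by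
  apply prod_hom_ext
  · simp [inl, lift_map_assoc, m'.lift_mul_zero, reassoc_of% m.lift_mul_zero]
  · simp [inr, lift_map_assoc, m'.lift_zero_mul, reassoc_of% m.lift_zero_mul]

theorem mul_comm : lift (snd A A) (fst A A) ≫ m.mul = m.mul := by
  apply prod_hom_ext
  · simp [comp_lift_assoc, m.lift_zero_mul, m.inl_mul]
  · simp [comp_lift_assoc, m.lift_mul_zero, m.inr_mul]

theorem mul_assoc : lift (fst A (A ⊗ A)) (snd A (A ⊗ A) ≫ m.mul) ≫ m.mul =
    lift (lift (fst A (A ⊗ A)) (snd A (A ⊗ A) ≫ fst A A) ≫ m.mul) (snd A (A ⊗ A) ≫ snd A A) ≫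
      m.mul := by
  apply prod_hom_ext
  · simp [comp_lift_assoc, m.lift_mul_zero]
  · apply prod_hom_ext
    · simp [comp_lift_assoc, m.lift_zero_mul, m.inl_mul]
    · simp [comp_lift_assoc, m.lift_zero_mul, m.inr_mul]

/-- The maps (s, t) ↦ x(t) + y(s) and (s, t) ↦ x'(t) + y(s) agree on the first axis, where both are
y, and on the diagonal, by hypothesis. The diagonal condition makes them equal, and restricting to
the second axis leaves x = x'. -/
theorem cancel_right {Z : C} (x x' y : Z ⟶ A) (h : lift x y ≫ m.mul = lift x' y ≫ m.mul) :
    x = x' := by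
  have key : lift (snd Z Z ≫ x) (fst Z Z ≫ y) ≫ m.mul =
      lift (snd Z Z ≫ x') (fst Z Z ≫ y) ≫ m.mul := by
    apply hom_ext_diag
    · simp [comp_lift_assoc]
    · simpa [comp_lift_assoc] using h
  have := inr Z Z ≫= key
  simpa [comp_lift_assoc, m.lift_mul_zero] using this

/-- Cancellation makes the shear map monic. It fixes the first axis and carries the second axis to
the diagonal, so strong unitality applies to it directly. The negative of a is then the solution x
of x + a = 0, read off from the inverse at (0, a). -/
instance shear_isIso : IsIso (lift m.mul (snd A A)) := by
  have : Mono (lift m.mul (snd A A)) := by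
    constructor
    intro Z u w h
    have h₂ : u ≫ snd A A = w ≫ snd A A := by simpa using h =≫ snd _ _
    have h₁ : u ≫ m.mul = w ≫ m.mul := by simpa using h =≫ fst _ _
    ext
    · apply m.cancel_right _ _ (u ≫ snd A A)
      rw [lift_comp_fst_snd, h₂, lift_comp_fst_snd, h₁]
    · exact h₂
  refine StronglyUnital.isIso_of_factors _ (inl A A) (inr A A) ?_ ?_
  · simp [comp_lift, m.inl_mul, quasiInj₁]
  · simp [comp_lift, m.inr_mul]

/-- The inverse for a unital magma structure in a strongly unital category. -/
def neg : A ⟶ A := inr A A ≫ inv (lift m.mul (snd A A)) ≫ fst A A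

theorem neg_mul : lift m.neg (𝟙 A) ≫ m.mul = 0 := by
  have h₀ : inv (lift m.mul (snd A A)) ≫ snd A A = snd A A := by
    rw [IsIso.inv_comp_eq, lift_snd]
  have h₁ : inv (lift m.mul (snd A A)) ≫ m.mul = fst A A := by
    rw [IsIso.inv_comp_eq, lift_fst]
  have : lift m.neg (𝟙 A) = inr A A ≫ inv (lift m.mul (snd A A)) := by
    ext <;> simp [neg, h₀]
  rw [this, Category.assoc, h₁, inr_fst]

/-- A unital magma in a strongly unital category is an abelian group object. -/
def toCommGrp [BraidedCategory C] : CommGrp C :=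
  letI g : GrpObj A :=
    { one := 0
      mul := m.mul
      one_mul := by
        have : (0 : 𝟙_ C ⟶ A) ▷ A = snd _ _ ≫ inr A A := by ext <;> simp
        rw [this, Category.assoc, m.inr_mul, leftUnitor_hom, Category.comp_id]
      mul_one := by
        have : A ◁ (0 : 𝟙_ C ⟶ A) = fst _ _ ≫ inl A A := by ext <;> simp
        rw [this, Category.assoc, m.inl_mul, rightUnitor_hom, Category.comp_id]
      mul_assoc := by
        have := (α_ A A A).hom ≫= m.mul_assoc
        have h₁ : (α_ A A A).hom ≫ lift (fst A (A ⊗ A)) (snd A (A ⊗ A) ≫ m.mul) =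
          (α_ A A A).hom ≫ A ◁ m.mul := by ext <;> simp
        have h₂ : (α_ A A A).hom ≫ lift (lift (fst A (A ⊗ A)) (snd A (A ⊗ A) ≫ fst A A) ≫ m.mul)
          (snd A (A ⊗ A) ≫ snd A A) = m.mul ▷ A := by
            ext <;> simp [comp_lift_assoc, lift_comp_fst_snd]
        rw [reassoc_of% h₁, reassoc_of% h₂] at this
        exact this.symm
      inv := m.neg
      left_inv := by rw [m.neg_mul, toUnit_comp]
      right_inv := by
        have : lift (𝟙 A) m.neg = lift m.neg (𝟙 A) ≫ lift (snd A A) (fst A A) := by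
          ext <;> simp
        rw [this, Category.assoc, m.mul_comm, m.neg_mul, toUnit_comp] }
  { X := A
    grp := g
    comm := ⟨by
      rw [← lift_snd_fst]
      exact m.mul_comm⟩ }

/-- The unital magma underlying a monoid object. -/
def ofMonObj (A : C) [MonObj A] : UnitalMul A where
  mul := μ[A]
  inl_mul := by
    rw [inl, ← toUnit_comp η[A], lift_comp_one_right]
  inr_mul := by
    rw [inr, ← toUnit_comp η[A], lift_comp_one_left]

end UnitalMul

@[simp]
theorem inl_mul (A : C) [MonObj A] : inl A A ≫ μ[A] = 𝟙 A := (UnitalMul.ofMonObj A).inl_mul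

@[simp]
theorem inr_mul (A : C) [MonObj A] : inr A A ≫ μ[A] = 𝟙 A := (UnitalMul.ofMonObj A).inr_mul

theorem inl_tensorHom {X Y X' Y' : C} (f : X ⟶ X') (g : Y ⟶ Y') :
    inl X Y ≫ (f ⊗ₘ g) = f ≫ inl X' Y' := by
  ext <;> simp

theorem inl_tensorHom_assoc {X Y X' Y' : C} (f : X ⟶ X') (g : Y ⟶ Y') {W : C} (k : X' ⊗ Y' ⟶ W) :
    inl X Y ≫ (f ⊗ₘ g) ≫ k = f ≫ inl X' Y' ≫ k := by
  simpa only [Category.assoc, Category.id_comp] using inl_tensorHom f g =≫ k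

theorem inr_tensorHom {X Y X' Y' : C} (f : X ⟶ X') (g : Y ⟶ Y') :
    inr X Y ≫ (f ⊗ₘ g) = g ≫ inr X' Y' := by
  ext <;> simp

theorem inr_tensorHom_assoc {X Y X' Y' : C} (f : X ⟶ X') (g : Y ⟶ Y') {W : C} (k : X' ⊗ Y' ⟶ W) :
    inr X Y ≫ (f ⊗ₘ g) ≫ k = g ≫ inr X' Y' ≫ k := by
  simpa only [Category.assoc, Category.id_comp] using inr_tensorHom f g =≫ k

/-- This is what makes the forgetful functor from abelian group objects full. -/
instance isMonHom {A B : C} [MonObj A] [MonObj B] (f : A ⟶ B) : IsMonHom f where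
  one_hom := by rw [hom_from_unit (η[A] ≫ f), hom_from_unit η[B]]
  mul_hom := (UnitalMul.ofMonObj A).mul_hom (UnitalMul.ofMonObj B) f

theorem hom_one_eq_zero {A X : C} [MonObj A] : (1 : X ⟶ A) = 0 := toUnit_comp η[A]

theorem zeroHom_mul {A X : C} [MonObj A] (f : X ⟶ A) : (0 : X ⟶ A) * f = f := by
  rw [← hom_one_eq_zero]
  exact _root_.one_mul f

theorem mul_zeroHom {A X : C} [MonObj A] (f : X ⟶ A) : f * (0 : X ⟶ A) = f := by
  rw [← hom_one_eq_zero]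
  exact _root_.mul_one f

theorem hom_mul_comp {X A B : C} [MonObj A] [MonObj B] (a b : X ⟶ A) (f : A ⟶ B) :
    (a * b) ≫ f = (a ≫ f) * (b ≫ f) := by
  rw [Hom.mul_def, Hom.mul_def, Category.assoc, IsMonHom.mul_hom, lift_map_assoc]

variable [BraidedCategory C]

/-- In a strongly unital category, abelian group objects form a full subcategory. -/
def commGrpHom {A B : CommGrp C} (f : A.X ⟶ B.X) : A ⟶ B :=
  InducedCategory.homMk (Grp.homMk' ⟨f⟩)

instance : (CommGrp.forget C).Full where
  map_surjective f := ⟨commGrpHom f, rfl⟩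

end Unital

end TangentCat

end
noncomputable section

set_option linter.unusedSectionVars false

namespace TangentCat

/-! ### Abelianization as the coequalizer of the two axes -/

section Abelianization

variable {C : Type u} [Category.{v} C] [CartesianMonoidalCategory C] [HasZeroMorphisms C]

section

variable [HasFiniteColimits C] (X : C)

/-- The coequalizer of the two injections `X ⟶ X × X`. -/
def abObj : C := coequalizer (inl X X) (inr X X)

/-- The quotient morphism onto the coequalizer of the two injections. -/
def abPi : X ⊗ X ⟶ abObj X := coequalizer.π (inl X X) (inr X X)

instance : Epi (abPi X) := inferInstanceAs (Epi (coequalizer.π _ _))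

variable {X} in
/-- The universal property of the coequalizer of the two injections. -/
def abObjDesc {Z : C} (f : X ⊗ X ⟶ Z) (h : inl X X ≫ f = inr X X ≫ f) : abObj X ⟶ Z :=
  coequalizer.desc f h

variable {X} in
theorem abPi_abObjDesc {Z : C} (f : X ⊗ X ⟶ Z) (h : inl X X ≫ f = inr X X ≫ f) :
    abPi X ≫ abObjDesc f h = f :=
  coequalizer.π_desc f h

variable {X} in
theorem abPi_abObjDesc_assoc {Z : C} (f : X ⊗ X ⟶ Z) (h : inl X X ≫ f = inr X X ≫ f) {W : C} (k : Z ⟶ W) :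
    abPi X ≫ abObjDesc f h ≫ k = f ≫ k := by
  simpa only [Category.assoc, Category.id_comp] using abPi_abObjDesc f h =≫ k

/-- The common composite of the two injections with the quotient morphism. -/
def abUnit : X ⟶ abObj X := inl X X ≫ abPi X

theorem inl_abPi : inl X X ≫ abPi X = abUnit X := rfl

theorem inr_abPi : inr X X ≫ abPi X = abUnit X := (coequalizer.condition _ _).symm

end

variable [HasFiniteColimits C] [StronglyUnital C] (X : C)

/-- If the unit factors through a monomorphism `i`, the pullback of `i` along the quotient map
contains both axes, hence is all of X × X. The quotient map then factors through `i`; since `i` is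
monic, this factorization still coequalizes the axes, and it descends to a section of `i`. -/
instance abUnit_extremalEpi : ExtremalEpi (abUnit X) := by
  apply ExtremalEpi.mk_of_hasEqualizers
  intro Z p i fac _
  have := isIso_of_factors_inl_inr (pullback.fst (abPi X) i)
    (pullback.lift (inl X X) p fac.symm) (pullback.lift (inr X X) p (by rw [fac, inr_abPi]))
    (pullback.lift_fst _ _ _) (pullback.lift_fst _ _ _)
  let d : abObj X ⟶ Z :=
    abObjDesc (inv (pullback.fst (abPi X) i) ≫ pullback.snd _ _) (by
      rw [← cancel_mono i]
      simp only [Category.assoc, ← pullback.condition, IsIso.inv_hom_id_assoc]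
      rw [inl_abPi, inr_abPi])
  have hd : d ≫ i = 𝟙 (abObj X) := by
    rw [← cancel_epi (abPi X)]
    simp only [d, abPi_abObjDesc_assoc, Category.assoc, ← pullback.condition,
      IsIso.inv_hom_id_assoc, Category.comp_id]
  exact ⟨d, by rw [← cancel_mono i, Category.assoc, hd, Category.comp_id, Category.id_comp], hd⟩

/-- Let the product map factor through a monomorphism. Pulled back to each axis of the target, that
monomorphism receives a factorization of `f` or `g`, so it contains both axes and is invertible. -/
theorem extremalEpi_tensorHom {X Y X' Y' : C} (f : X ⟶ X') (g : Y ⟶ Y') [ExtremalEpi f]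
    [ExtremalEpi g] : ExtremalEpi (f ⊗ₘ g) := by
  apply ExtremalEpi.mk_of_hasEqualizers
  intro Z p i fac _
  have h₁ : IsIso (pullback.fst (inl X' Y') i) :=
    ExtremalEpi.isIso f (pullback.lift f (inl X Y ≫ p) (by rw [Category.assoc, fac, inl_tensorHom])) _
      (pullback.lift_fst _ _ _)
  have h₂ : IsIso (pullback.fst (inr X' Y') i) :=
    ExtremalEpi.isIso g (pullback.lift g (inr X Y ≫ p) (by rw [Category.assoc, fac, inr_tensorHom])) _
      (pullback.lift_fst _ _ _)
  refine isIso_of_factors_inl_inr i (inv (pullback.fst (inl X' Y') i) ≫ pullback.snd _ _)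
    (inv (pullback.fst (inr X' Y') i) ≫ pullback.snd _ _) ?_ ?_ <;>
  simp [← pullback.condition]

variable [Regular C]

/-- In a regular category the extremal epimorphism `abUnit X ⊗ₘ abUnit X` is a regular epimorphism,
so it is enough that `abPi X` identifies what this map identifies. This can be tested on the product
of two kernel pairs of the unit, hence on its axes, where `abPi X` restricts to the unit. -/
theorem exists_abMul :
    ∃ m : abObj X ⊗ abObj X ⟶ abObj X, (abUnit X ⊗ₘ abUnit X) ≫ m = abPi X := by
  have := extremalEpi_tensorHom (abUnit X) (abUnit X)
  let r := Regular.regularEpiOfExtremalEpi (abUnit X ⊗ₘ abUnit X)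
  have hk : (pullback.fst (abUnit X) (abUnit X) ⊗ₘ pullback.fst (abUnit X) (abUnit X)) ≫ abPi X =
      (pullback.snd (abUnit X) (abUnit X) ⊗ₘ pullback.snd (abUnit X) (abUnit X)) ≫ abPi X := by
    apply prod_hom_ext
    · rw [inl_tensorHom_assoc, inl_tensorHom_assoc, inl_abPi, pullback.condition]
    · rw [inr_tensorHom_assoc, inr_tensorHom_assoc, inr_abPi, pullback.condition]
  have h₁ : (r.left ≫ fst _ _) ≫ abUnit X = (r.right ≫ fst _ _) ≫ abUnit X := by
    simpa using r.w =≫ fst _ _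
  have h₂ : (r.left ≫ snd _ _) ≫ abUnit X = (r.right ≫ snd _ _) ≫ abUnit X := by
    simpa using r.w =≫ snd _ _
  -- The parallel pair presenting the regular epimorphism factors, coordinate by coordinate, through
  -- the product of kernel pairs.
  have h := lift (pullback.lift _ _ h₁) (pullback.lift _ _ h₂) ≫= hk
  simp only [lift_map_assoc, pullback.lift_fst, pullback.lift_snd, lift_comp_fst_snd] at h
  exact ⟨r.desc' (abPi X) h |>.1, (r.desc' (abPi X) h).2⟩

/-- The multiplication on the abelianization of `X`. -/
def abMul : UnitalMul (abObj X) where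
  mul := (exists_abMul X).choose
  inl_mul := by
    rw [← cancel_epi (abUnit X), ← inl_tensorHom_assoc _ (abUnit X), (exists_abMul X).choose_spec, inl_abPi,
      Category.comp_id]
  inr_mul := by
    rw [← cancel_epi (abUnit X), ← inr_tensorHom_assoc (abUnit X), (exists_abMul X).choose_spec, inr_abPi,
      Category.comp_id]

theorem abUnit_abMul : (abUnit X ⊗ₘ abUnit X) ≫ (abMul X).mul = abPi X :=
  (exists_abMul X).choose_spec

variable {X} in
/-- The universal property of the abelianization. -/
def abDesc {A : C} [MonObj A] (f : X ⟶ A) : abObj X ⟶ A :=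
  abObjDesc ((f ⊗ₘ f) ≫ μ[A]) (by
    rw [inl_tensorHom_assoc, inr_tensorHom_assoc, inl_mul, inr_mul])

variable {X} in
theorem abUnit_abDesc {A : C} [MonObj A] (f : X ⟶ A) : abUnit X ≫ abDesc f = f := by
  rw [abUnit, abDesc, Category.assoc, abPi_abObjDesc, inl_tensorHom_assoc, inl_mul,
    Category.comp_id]

variable {X} in
theorem abUnit_abDesc_assoc {A : C} [MonObj A] (f : X ⟶ A) {W : C} (k : A ⟶ W) :
    abUnit X ≫ abDesc f ≫ k = f ≫ k := by
  simpa only [Category.assoc, Category.id_comp] using abUnit_abDesc f =≫ k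

variable [BraidedCategory C]

/-- The explicit abelianization represents morphisms to abelian group objects. -/
def abHomEquiv (X : C) (A : CommGrp C) : ((abMul X).toCommGrp ⟶ A) ≃ (X ⟶ A.X) where
  toFun f := abUnit X ≫ f.hom.hom.hom
  invFun f := commGrpHom (abDesc f)
  left_inv f := by
    ext
    apply (cancel_epi (abUnit X)).1
    exact abUnit_abDesc _
  right_inv f := abUnit_abDesc f

theorem forget_isRightAdjoint : (CommGrp.forget C).IsRightAdjoint :=
  (Adjunction.adjunctionOfEquivLeft (G := CommGrp.forget C)
    (F_obj := fun X => (abMul X).toCommGrp) abHomEquiv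
    (fun _ _ _ _ _ => (Category.assoc _ _ _).symm)).isRightAdjoint

instance (L : C ⥤ CommGrp C) (X : C) : GrpObj ((underlying L).obj X) :=
  inferInstanceAs (GrpObj (L.obj X).X)

instance (L : C ⥤ CommGrp C) (X : C) : IsCommMonObj ((underlying L).obj X) :=
  inferInstanceAs (IsCommMonObj (L.obj X).X)

/-! ### Comparison with an arbitrary left adjoint -/

section Adj

variable {Ab : C ⥤ CommGrp C} (adj : Ab ⊣ CommGrp.forget C)

/-- The unit of the adjunction. -/
def etaL (X : C) : X ⟶ (underlying Ab).obj X := adj.unit.app X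

theorem etaL_map {X Y : C} (f : X ⟶ Y) :
    etaL adj X ≫ (underlying Ab).map f = f ≫ etaL adj Y :=
  (adj.unit.naturality f).symm

theorem etaL_map_assoc {X Y : C} (f : X ⟶ Y) {W : C} (k : (underlying Ab).obj Y ⟶ W) :
    etaL adj X ≫ (underlying Ab).map f ≫ k = f ≫ etaL adj Y ≫ k := by
  simpa only [Category.assoc, Category.id_comp] using etaL_map adj f =≫ k

variable {X} in
/-- The factorization through the unit of the adjunction. -/
def adjDesc {A : CommGrp C} (f : X ⟶ A.X) : (underlying Ab).obj X ⟶ A.X :=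
  (CommGrp.forget C).map ((adj.homEquiv X A).symm f)

variable {X} in
theorem etaL_adjDesc {A : CommGrp C} (f : X ⟶ A.X) : etaL adj X ≫ adjDesc adj f = f :=
  (adj.homEquiv_unit X A _).symm.trans ((adj.homEquiv X A).apply_symm_apply f)

variable {X} in
theorem etaL_adjDesc_assoc {A : CommGrp C} (f : X ⟶ A.X) {W : C} (k : A.X ⟶ W) :
    etaL adj X ≫ adjDesc adj f ≫ k = f ≫ k := by
  simpa only [Category.assoc, Category.id_comp] using etaL_adjDesc adj f =≫ k

variable {X} in
-- Fullness turns arbitrary morphisms of the ambient category into homomorphisms, to which the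
-- adjunction applies.
theorem etaL_hom_ext {A : CommGrp C} {f g : (underlying Ab).obj X ⟶ A.X}
    (h : etaL adj X ≫ f = etaL adj X ≫ g) : f = g := by
  have : commGrpHom (A := Ab.obj X) f = commGrpHom (A := Ab.obj X) g :=
    (adj.homEquiv X A).injective (by
      refine (adj.homEquiv_unit _ _ _).trans (Eq.trans h ?_)
      exact (adj.homEquiv_unit X A (commGrpHom (A := Ab.obj X) g)).symm)
  exact congrArg (CommGrp.forget C).map this

/-- The comparison of the explicit abelianization with a given left adjoint. -/
def abObjIso (X : C) : abObj X ≅ (underlying Ab).obj X where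
  hom := abDesc (etaL adj X)
  inv := adjDesc adj (A := (abMul X).toCommGrp) (abUnit X)
  hom_inv_id := by
    rw [← cancel_epi (abUnit X)]
    refine (abUnit_abDesc_assoc _ _).trans ?_
    exact (etaL_adjDesc adj (A := (abMul X).toCommGrp) (abUnit X)).trans (Category.comp_id _).symm
  inv_hom_id := by
    apply etaL_hom_ext adj (A := Ab.obj X)
    refine (etaL_adjDesc_assoc adj (A := (abMul X).toCommGrp) (abUnit X) _).trans ?_
    exact (abUnit_abDesc _).trans (Category.comp_id _).symm

theorem abUnit_abObjIso : abUnit X ≫ (abObjIso adj X).hom = etaL adj X := abUnit_abDesc _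

/-- The comparison isomorphism is automatically additive, and the quotient map is the sum of two
copies of the unit. -/
theorem abPi_abObjIso : abPi X ≫ (abObjIso adj X).hom = abQuot adj X := by
  have h : (abMul X).mul ≫ (abObjIso adj X).hom =
      ((abObjIso adj X).hom ⊗ₘ (abObjIso adj X).hom) ≫ μ[(underlying Ab).obj X] :=
    (abMul X).mul_hom (UnitalMul.ofMonObj _) (abObjIso adj X).hom
  rw [← abUnit_abMul, Category.assoc, h, tensorHom_comp_tensorHom_assoc, abUnit_abObjIso]
  rfl

/-- The adjunction alone only separates morphisms into abelian group objects; the explicit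
coequalizer shows that the unit separates morphisms into every object. -/
instance etaL_epi : Epi (etaL adj X) := by
  rw [← abUnit_abObjIso]
  exact epi_comp _ _

theorem abQuot_isCoequalizer : ∃ w : quasiInj₁ X ≫ abQuot adj X = quasiInj₂ X ≫ abQuot adj X,
    Nonempty (IsColimit (Cofork.ofπ (abQuot adj X) w)) := by
  have w : quasiInj₁ X ≫ abQuot adj X = quasiInj₂ X ≫ abQuot adj X := by
    rw [← abPi_abObjIso]
    exact (coequalizer.condition_assoc (inl X X) (inr X X) _)
  refine ⟨w, ⟨IsColimit.ofIsoColimit (coequalizerIsCoequalizer (inl X X) (inr X X))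
    (Cofork.ext (abObjIso adj X) (abPi_abObjIso X adj))⟩⟩

end Adj

end Abelianization

end TangentCat

end
noncomputable section

set_option linter.unusedSectionVars false

namespace TangentCat

/-! ### The additive assignment of the abelianization -/

section Assignment

variable {C : Type u} [Category.{v} C] [CartesianMonoidalCategory C] [HasZeroMorphisms C]
  [HasFiniteColimits C] [StronglyUnital C] [Regular C] [BraidedCategory C]
  {Ab : C ⥤ CommGrp C} (adj : Ab ⊣ CommGrp.forget C)

/-- The formula f(x, y) = f(x, 0) + f(0, y) holds on both axes. -/
theorem inl_inr_mul (X Y : C) {A : C} [MonObj A] (f : X ⊗ Y ⟶ A) :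
    (fst X Y ≫ inl X Y ≫ f) * (snd X Y ≫ inr X Y ≫ f) = f := by
  apply prod_hom_ext
  · rw [MonObj.comp_mul, inl_fst_assoc, inl_snd_assoc, zero_comp, mul_zeroHom]
  · rw [MonObj.comp_mul, inr_fst_assoc, inr_snd_assoc, zero_comp, zeroHom_mul]

include adj

theorem underlying_map_zero (X Y : C) : (underlying Ab).map (0 : X ⟶ Y) = 0 := by
  rw [← cancel_epi (etaL adj X), etaL_map, zero_comp, comp_zero]

theorem underlying_map_mul {X A : C} [MonObj A] (f g : X ⟶ A) :
    (underlying Ab).map (f * g) = (underlying Ab).map f * (underlying Ab).map g := by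
  rw [← cancel_epi (etaL adj X), MonObj.comp_mul, etaL_map, etaL_map, etaL_map, hom_mul_comp]

theorem underlying_map_etaL (X : C) :
    (underlying Ab).map (etaL adj X) = etaL adj ((underlying Ab).obj X) := by
  rw [← cancel_epi (etaL adj X), etaL_map]

theorem underlying_preservesFiniteProducts : PreservesFiniteProducts (underlying Ab) := by
  have h₁ : ∀ X Y : C, IsIso (CartesianMonoidalCategory.prodComparison (underlying Ab) X Y) := by
    intro X Y
    -- As for biproducts, the inverse of the comparison is (a, b) ↦ L(ι₁)(a) + L(ι₂)(b). One
    -- composite is checked after the epic unit, where it says η(x, 0) + η(0, y) = η(x, y).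
    refine ⟨(fst _ _ ≫ (underlying Ab).map (inl X Y)) * (snd _ _ ≫ (underlying Ab).map (inr X Y)),
      ?_, ?_⟩
    · rw [MonObj.comp_mul, CartesianMonoidalCategory.prodComparison_fst_assoc,
        CartesianMonoidalCategory.prodComparison_snd_assoc, ← Functor.map_comp, ← Functor.map_comp,
        ← cancel_epi (etaL adj _), MonObj.comp_mul, etaL_map, etaL_map, Category.assoc,
        Category.assoc, inl_inr_mul, Category.comp_id]
    · ext
      · rw [Category.assoc, CartesianMonoidalCategory.prodComparison_fst, hom_mul_comp,
          Category.assoc, Category.assoc, ← Functor.map_comp, ← Functor.map_comp, inl_fst,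
          inr_fst, underlying_map_zero adj, comp_zero, mul_zeroHom, CategoryTheory.Functor.map_id, Category.comp_id, Category.id_comp]
      · rw [Category.assoc, CartesianMonoidalCategory.prodComparison_snd, hom_mul_comp,
          Category.assoc, Category.assoc, ← Functor.map_comp, ← Functor.map_comp, inr_snd,
          inl_snd, underlying_map_zero adj, comp_zero, zeroHom_mul, CategoryTheory.Functor.map_id, Category.comp_id, Category.id_comp]
  have h₂ : IsIso (CartesianMonoidalCategory.terminalComparison (underlying Ab)) := by
    refine ⟨0, ?_, toUnit_unique _ _⟩
    rw [comp_zero, ← cancel_epi (etaL adj _), hom_from_unit (etaL adj _ ≫ 𝟙 _), comp_zero]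
  have := preservesLimitsOfShape_discrete_walkingPair_of_isIso_prodComparison (underlying Ab)
  have := preservesLimit_empty_of_isIso_terminalComparison (underlying Ab)
  have : PreservesLimitsOfShape (Discrete PEmpty.{1}) (underlying Ab) :=
    preservesLimitsOfShape_pempty_of_preservesTerminal _
  exact PreservesFiniteProducts.of_preserves_binary_and_terminal _

theorem etaL_abNu (X : C) :
    etaL adj ((underlying Ab).obj X) ≫ (CommGrp.forget C).map ((abNu adj).app X) =
      𝟙 ((underlying Ab).obj X) :=
  adj.right_triangle_components (Ab.obj X)

/-- The counit of a reflection is invertible, since the right adjoint is fully faithful. -/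
instance isIso_abNu_app (X : C) : IsIso ((abNu adj).app X) :=
  inferInstanceAs (IsIso (adj.counit.app (Ab.obj X)))

theorem isAdditiveAssignment : IsAdditiveAssignment Ab (abNu adj) where
  preservesFiniteProducts := underlying_preservesFiniteProducts adj
  isIso := NatIso.isIso_of_isIso_app _
  comm X := by
    -- Naturality of the counit at one of its own components, followed by cancelling that invertible
    -- component.
    have h := adj.counit.naturality (adj.counit.app (Ab.obj X))
    exact ((cancel_mono (adj.counit.app (Ab.obj X))).1 h).symm

/-- By a triangle identity. The vertical lift is thereby expressed through the unit, and its axioms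
become instances of naturality. -/
theorem nuInv_eq (h : IsAdditiveAssignment Ab (abNu adj)) (X : C) :
    h.nuInv X = etaL adj ((underlying Ab).obj X) := by
  have hi := h.isIso
  have h₁ : (CommGrp.forget C).map ((abNu adj).app X) ≫ h.nuInv X = 𝟙 _ := by
    have : (abNu adj).app X ≫ (inv (abNu adj)).app X = 𝟙 _ := by
      rw [← NatTrans.comp_app, IsIso.hom_inv_id, NatTrans.id_app]
    exact congrArg (CommGrp.forget C).map this
  exact (Category.id_comp _).symm.trans ((etaL_abNu adj X =≫ h.nuInv X).symm.trans
    ((Category.assoc _ _ _).trans ((etaL adj _ ≫= h₁).trans (Category.comp_id _))))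

end Assignment

end TangentCat

end
noncomputable section

set_option linter.unusedSectionVars false

namespace TangentCat

/-! ### Product preserving functors and fibre powers of projections -/

section ProductPreserving

variable {C : Type u} [Category.{v} C] [CartesianMonoidalCategory C]

section

variable (F : C ⥤ C) [PreservesFiniteProducts F]

theorem map_prod_hom_ext {X Y Z : C} {f g : Z ⟶ F.obj (X ⊗ Y)}
    (h₁ : f ≫ F.map (fst X Y) = g ≫ F.map (fst X Y))
    (h₂ : f ≫ F.map (snd X Y) = g ≫ F.map (snd X Y)) : f = g := by
  rw [← cancel_mono (CartesianMonoidalCategory.prodComparison F X Y)]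
  ext
  · simpa using h₁
  · simpa using h₂

/-- The pairing into the image of a product under a product preserving functor. -/
def mapLift {X Y Z : C} (f : Z ⟶ F.obj X) (g : Z ⟶ F.obj Y) : Z ⟶ F.obj (X ⊗ Y) :=
  lift f g ≫ inv (CartesianMonoidalCategory.prodComparison F X Y)

@[simp]
theorem mapLift_fst {X Y Z : C} (f : Z ⟶ F.obj X) (g : Z ⟶ F.obj Y) :
    mapLift F f g ≫ F.map (fst X Y) = f := by
  simp [mapLift]

@[simp]
theorem mapLift_fst_assoc {X Y Z : C} (f : Z ⟶ F.obj X) (g : Z ⟶ F.obj Y) {W : C} (k : F.obj X ⟶ W) :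
    mapLift F f g ≫ F.map (fst X Y) ≫ k = f ≫ k := by
  simpa only [Category.assoc, Category.id_comp] using mapLift_fst F f g =≫ k

@[simp]
theorem mapLift_snd {X Y Z : C} (f : Z ⟶ F.obj X) (g : Z ⟶ F.obj Y) :
    mapLift F f g ≫ F.map (snd X Y) = g := by
  simp [mapLift]

@[simp]
theorem mapLift_snd_assoc {X Y Z : C} (f : Z ⟶ F.obj X) (g : Z ⟶ F.obj Y) {W : C} (k : F.obj Y ⟶ W) :
    mapLift F f g ≫ F.map (snd X Y) ≫ k = g ≫ k := by
  simpa only [Category.assoc, Category.id_comp] using mapLift_snd F f g =≫ k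

end

/-- The family consisting of `X` and `n` copies of `A`. -/
abbrev powerFamily (X A : C) (n : ℕ) : Option (Fin n) → C
  | none => X
  | some _ => A

/-- The projections of a cone over the powers of a projection `X × A ⟶ X` to `X` and to the copies
of `A`. -/
def powerProj {X A : C} {n : ℕ} (c : Cone (powerDiagram (fst X A) n)) :
    ∀ j : Option (Fin n), c.pt ⟶ powerFamily X A n j
  | none => c.π.app none
  | some i => c.π.app (some i) ≫ snd X A

/-- The pullback powers of a projection `X × A ⟶ X` are products of `X` and copies of `A`. -/
def isLimitPowerFan {X A : C} {n : ℕ} {c : Cone (powerDiagram (fst X A) n)} (hc : IsLimit c) :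
    IsLimit (Fan.mk c.pt (powerProj c)) :=
  let k (s : Fan (powerFamily X A n)) : Cone (powerDiagram (fst X A) n) :=
    WidePullbackShape.mkCone (F := powerDiagram (fst X A) n) (s.proj none)
      (fun i => lift (s.proj none) (s.proj (some i))) (fun _ => lift_fst _ _)
  Fan.IsLimit.mk _ (fun s => hc.lift (k s))
    (fun s j => by
      rcases j with _ | i
      · exact hc.fac (k s) none
      · exact (Category.assoc _ _ _).symm.trans
          ((hc.fac (k s) (some i) =≫ snd X A).trans (lift_snd _ _)))
    (fun s m hm => by
      refine hc.uniq (k s) m fun j => ?_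
      rcases j with _ | i
      · exact hm none
      · refine CartesianMonoidalCategory.hom_ext _ _ ?_ ?_
        · refine (Category.assoc _ _ _).trans (Eq.trans ?_ (lift_fst _ _).symm)
          exact (m ≫= c.w (WidePullbackShape.Hom.term i)).trans (hm none)
        · refine (Category.assoc _ _ _).trans (Eq.trans ?_ (lift_snd _ _).symm)
          exact hm (some i))

/-- The functor is not assumed to preserve pullbacks: a fibre power of a product projection is the
finite product of X with copies of A, and maps into the image of X × A are determined by their two
coordinates. -/
theorem preservesPowers_fst (F : C ⥤ C) [PreservesFiniteProducts F] (X A : C) :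
    PreservesPowers F (fst X A) := by
  intro n
  refine ⟨fun {c} hc => ⟨?_⟩⟩
  have hF := isLimitFanMkObjOfIsLimit F _ _ (isLimitPowerFan hc)
  let k (s : Cone (powerDiagram (fst X A) n ⋙ F)) :
      Fan (fun j => F.obj (powerFamily X A n j)) :=
    Fan.mk s.pt fun j => match j with
      | none => s.π.app none
      | some i => s.π.app (some i) ≫ F.map (snd X A)
  have hw (s : Cone (powerDiagram (fst X A) n ⋙ F)) (i : Fin n) :
      s.π.app (some i) ≫ F.map (fst X A) = s.π.app none := s.w (WidePullbackShape.Hom.term i)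
  have key (s : Cone (powerDiagram (fst X A) n ⋙ F)) (m : s.pt ⟶ F.obj c.pt) (i : Fin n)
      (h : m ≫ F.map (powerProj c (some i)) = s.π.app (some i) ≫ F.map (snd X A))
      (h₀ : m ≫ F.map (powerProj c none) = s.π.app none) :
      m ≫ F.map (c.π.app (some i)) = s.π.app (some i) := by
    refine map_prod_hom_ext F ?_ ?_
    · refine (Category.assoc _ _ _).trans (((m ≫= (F.map_comp _ _).symm).trans ?_).trans
        (hw s i).symm)
      exact (m ≫= congrArg F.map (c.w (WidePullbackShape.Hom.term i))).trans h₀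
    · refine (Category.assoc _ _ _).trans ((m ≫= (F.map_comp _ _).symm).trans h)
  exact
    { lift := fun s => hF.lift (k s)
      fac := fun s j => by
        rcases j with _ | i
        · exact hF.fac (k s) ⟨none⟩
        · exact key s _ i (hF.fac (k s) ⟨some i⟩) (hF.fac (k s) ⟨none⟩)
      uniq := fun s m hm => by
        refine hF.uniq (k s) m fun ⟨j⟩ => ?_
        rcases j with _ | i
        · exact hm none
        · refine (m ≫= F.map_comp _ _).trans ((Category.assoc _ _ _).symm.trans ?_)
          exact hm (some i) =≫ _ }

end ProductPreserving

/-! ### Trivial additive bundles -/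

section ProdBundle

variable {C : Type u} [Category.{v} C] [CartesianMonoidalCategory C]

/-- The trivial bundle `X × A ⟶ X` with fibre a monoid object `A`. -/
abbrev prodBundle (X A : C) [MonObj A] : BundleData X where
  E := X ⊗ A
  q := fst X A
  E₂ := X ⊗ (A ⊗ A)
  ρ₁ := 𝟙 X ⊗ₘ fst A A
  ρ₂ := 𝟙 X ⊗ₘ snd A A
  isPullback := isPullback_proj X A
  sum := 𝟙 X ⊗ₘ μ[A]
  zero := lift (𝟙 X) (toUnit X ≫ η[A])

variable {X A : C} [MonObj A]

theorem tensorHom_mul_snd : (𝟙 X ⊗ₘ μ[A]) ≫ snd X A =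
    ((𝟙 X ⊗ₘ fst A A) ≫ snd X A) * ((𝟙 X ⊗ₘ snd A A) ≫ snd X A) := by
  rw [Hom.mul_def, tensorHom_snd, tensorHom_snd, tensorHom_snd, ← comp_lift_assoc, lift_fst_snd,
    Category.id_comp]

/-- Stating this for any `w` with prescribed projections lets it apply to a pairing without
unfolding the chosen lift into the pullback. -/
theorem comp_tensorHom_mul {Z : C} {w : Z ⟶ X ⊗ (A ⊗ A)} {a b : Z ⟶ X ⊗ A}
    (h₁ : w ≫ (𝟙 X ⊗ₘ fst A A) = a) (h₂ : w ≫ (𝟙 X ⊗ₘ snd A A) = b) :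
    w ≫ (𝟙 X ⊗ₘ μ[A]) = lift (a ≫ fst X A) ((a ≫ snd X A) * (b ≫ snd X A)) := by
  subst h₁ h₂
  refine CartesianMonoidalCategory.hom_ext _ _ ?_ ?_
  · rw [lift_fst, Category.assoc, Category.assoc, tensorHom_fst, tensorHom_fst]
  · rw [lift_snd, Category.assoc, tensorHom_mul_snd, MonObj.comp_mul, Category.assoc,
      Category.assoc]

theorem prodBundle_pair_sum {Z : C} (a b : Z ⟶ X ⊗ A)
    (h : a ≫ (prodBundle X A).q = b ≫ (prodBundle X A).q) :
    (prodBundle X A).pair a b h ≫ (prodBundle X A).sum =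
      lift (a ≫ fst X A) ((a ≫ snd X A) * (b ≫ snd X A)) :=
  comp_tensorHom_mul (IsPullback.lift_fst _ _ _ _) (IsPullback.lift_snd _ _ _ _)

theorem prodBundle_isAdditive [BraidedCategory C] [IsCommMonObj A] [HasFiniteLimits C] :
    (prodBundle X A).IsAdditive where
  isBundle n := inferInstance
  sum_q := (tensorHom_fst _ _).trans (tensorHom_fst _ _).symm
  zero_q := lift_fst _ _
  assoc a b c hab hbc := by
    refine (prodBundle_pair_sum _ _ _).trans (Eq.trans ?_ (prodBundle_pair_sum _ _ _).symm)
    have e₁ := prodBundle_pair_sum a b hab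
    have e₂ := prodBundle_pair_sum b c hbc
    generalize (prodBundle X A).pair a b hab ≫ (prodBundle X A).sum = w₁ at e₁ ⊢
    generalize (prodBundle X A).pair b c hbc ≫ (prodBundle X A).sum = w₂ at e₂ ⊢
    subst e₁ e₂
    rw [lift_fst, lift_snd, lift_snd, _root_.mul_assoc]
  zero_sum := by
    refine (prodBundle_pair_sum _ _ _).trans ?_
    refine CartesianMonoidalCategory.hom_ext _ _ ?_ ?_
    · rw [lift_fst]
      change (fst X A ≫ lift (𝟙 X) (toUnit X ≫ η[A])) ≫ fst X A = 𝟙 (X ⊗ A) ≫ fst X A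
      simp
    · rw [lift_snd]
      change ((fst X A ≫ lift (𝟙 X) (toUnit X ≫ η[A])) ≫ snd X A) * (𝟙 (X ⊗ A) ≫ snd X A) =
        𝟙 (X ⊗ A) ≫ snd X A
      rw [Category.assoc, lift_snd, comp_toUnit_assoc]
      exact _root_.one_mul _
  sum_zero := by
    refine (prodBundle_pair_sum _ _ _).trans ?_
    refine CartesianMonoidalCategory.hom_ext _ _ ?_ ?_
    · rw [lift_fst]
    · rw [lift_snd]
      change (𝟙 (X ⊗ A) ≫ snd X A) * ((fst X A ≫ lift (𝟙 X) (toUnit X ≫ η[A])) ≫ snd X A) =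
        𝟙 (X ⊗ A) ≫ snd X A
      rw [Category.assoc, lift_snd, comp_toUnit_assoc]
      exact _root_.mul_one _
  sum_comm := by
    refine (prodBundle_pair_sum _ _ _).trans ?_
    change lift ((𝟙 X ⊗ₘ snd A A) ≫ fst X A)
      (((𝟙 X ⊗ₘ snd A A) ≫ snd X A) * ((𝟙 X ⊗ₘ fst A A) ≫ snd X A)) = (𝟙 X ⊗ₘ μ[A])
    rw [_root_.mul_comm, ← tensorHom_mul_snd]
    ext <;> simp

end ProdBundle

end TangentCat

end
noncomputable section

set_option linter.unusedSectionVars false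

namespace TangentCat

/-! ### The vertical lift of a trivial bundle -/

section TrivialBundle

variable {C : Type u} [Category.{v} C] [CartesianMonoidalCategory C] [HasZeroMorphisms C]
  [HasFiniteColimits C] [StronglyUnital C] [Regular C] [BraidedCategory C]
  {Ab : C ⥤ CommGrp C} (adj : Ab ⊣ CommGrp.forget C)

theorem zeroTo_eq (L : C ⥤ CommGrp C) (Y X : C) : zeroTo L Y X = 0 := toUnit_comp _

theorem zeroSec_eq (L : C ⥤ CommGrp C) (X : C) :
    IsAdditiveAssignment.zeroSec L X = inl X ((underlying L).obj X) := by
  rw [IsAdditiveAssignment.zeroSec, zeroTo_eq, inl]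

theorem lift_unit_eq (X A : C) [MonObj A] : lift (𝟙 X) (toUnit X ≫ η[A]) = inl X A := by
  rw [toUnit_comp, inl]

/-- The unit at an abelian group object is an isomorphism. -/
instance isIso_etaL (A : CommGrp C) : IsIso (etaL adj A.X) := by
  refine ⟨adjDesc adj (𝟙 A.X), etaL_adjDesc adj _, ?_⟩
  apply etaL_hom_ext adj (A := Ab.obj A.X)
  exact (etaL_adjDesc_assoc adj (𝟙 A.X) _).trans
    ((Category.id_comp _).trans (Category.comp_id _).symm)

include adj in
theorem underlying_hom_ext {X Y Z : C} {f g : Z ⟶ (underlying Ab).obj (X ⊗ Y)}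
    (h₁ : f ≫ (underlying Ab).map (fst X Y) = g ≫ (underlying Ab).map (fst X Y))
    (h₂ : f ≫ (underlying Ab).map (snd X Y) = g ≫ (underlying Ab).map (snd X Y)) : f = g :=
  haveI := underlying_preservesFiniteProducts adj
  map_prod_hom_ext _ h₁ h₂

/-- The vertical lift `(x, a) ↦ ((x, 0), (0, η a))` of the trivial bundle `X × A ⟶ X`. -/
def trivLift (X A : C) : X ⊗ A ⟶ (X ⊗ A) ⊗ (underlying Ab).obj (X ⊗ A) :=
  lift (fst X A ≫ inl X A) (snd X A ≫ inr X A ≫ etaL adj (X ⊗ A))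

@[simp]
theorem trivLift_fst (X A : C) : trivLift adj X A ≫ fst _ _ = fst X A ≫ inl X A := lift_fst _ _

@[simp]
theorem trivLift_fst_assoc (X A : C) {W : C} (k : X ⊗ A ⟶ W) :
    trivLift adj X A ≫ fst _ _ ≫ k = fst X A ≫ inl X A ≫ k := by
  simpa only [Category.assoc, Category.id_comp] using trivLift_fst adj X A =≫ k

@[simp]
theorem trivLift_snd (X A : C) :
    trivLift adj X A ≫ snd _ _ = snd X A ≫ inr X A ≫ etaL adj (X ⊗ A) := lift_snd _ _

@[simp]
theorem trivLift_snd_assoc (X A : C) {W : C} (k : (underlying Ab).obj (X ⊗ A) ⟶ W) :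
    trivLift adj X A ≫ snd _ _ ≫ k = snd X A ≫ inr X A ≫ etaL adj (X ⊗ A) ≫ k := by
  simpa only [Category.assoc, Category.id_comp] using trivLift_snd adj X A =≫ k

/-- By naturality of the unit, η(0, a) has coordinates 0 and η(a) under the identification of L(X ×
L(X)) with L(X) × LL(X). -/
theorem vertLift_eq (h : IsAdditiveAssignment Ab (abNu adj)) (X : C) :
    h.vertLift X = trivLift adj X ((underlying Ab).obj X) := by
  have := h.preservesFiniteProducts
  rw [IsAdditiveAssignment.vertLift, zeroSec_eq, zeroTo_eq, nuInv_eq, trivLift,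
    tensorHom_comp_tensorHom, Category.comp_id]
  refine CartesianMonoidalCategory.hom_ext _ _ ?_ ?_
  · rw [tensorHom_fst, lift_fst]
  · rw [tensorHom_snd, lift_snd]
    apply underlying_hom_ext adj
    · rw [Category.assoc, Category.assoc, IsAdditiveAssignment.omegaInv,
        CartesianMonoidalCategory.inv_prodComparison_map_fst, lift_fst, Category.assoc,
        Category.assoc, etaL_map, inr_fst_assoc, zero_comp, comp_zero]
    · rw [Category.assoc, Category.assoc, IsAdditiveAssignment.omegaInv,
        CartesianMonoidalCategory.inv_prodComparison_map_snd, lift_snd, Category.assoc,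
        Category.assoc, etaL_map, inr_snd_assoc]

variable {X A : C} [MonObj A]

include adj in
/-- The image under the tangent bundle functor of the sum of a trivial bundle, in components. -/
theorem comp_tensorHom_map_mul {Z : C}
    {w : Z ⟶ (X ⊗ (A ⊗ A)) ⊗ (underlying Ab).obj (X ⊗ (A ⊗ A))}
    {a b c : Z ⟶ (X ⊗ A) ⊗ (underlying Ab).obj (X ⊗ A)}
    (h₁ : w ≫ ((𝟙 X ⊗ₘ fst A A) ⊗ₘ (underlying Ab).map (𝟙 X ⊗ₘ fst A A)) = a)
    (h₂ : w ≫ ((𝟙 X ⊗ₘ snd A A) ⊗ₘ (underlying Ab).map (𝟙 X ⊗ₘ snd A A)) = b)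
    (c₁ : c ≫ fst _ _ =
      lift (a ≫ fst _ _ ≫ fst _ _) ((a ≫ fst _ _ ≫ snd _ _) * (b ≫ fst _ _ ≫ snd _ _)))
    (c₂ : c ≫ snd _ _ ≫ (underlying Ab).map (fst X A) =
      a ≫ snd _ _ ≫ (underlying Ab).map (fst X A))
    (c₃ : c ≫ snd _ _ ≫ (underlying Ab).map (snd X A) =
      (a ≫ snd _ _ ≫ (underlying Ab).map (snd X A)) *
        (b ≫ snd _ _ ≫ (underlying Ab).map (snd X A))) :
    w ≫ ((𝟙 X ⊗ₘ μ[A]) ⊗ₘ (underlying Ab).map (𝟙 X ⊗ₘ μ[A])) = c := by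
  subst h₁ h₂
  refine CartesianMonoidalCategory.hom_ext _ _ ?_ ?_
  · rw [c₁, Category.assoc, tensorHom_fst, ← Category.assoc, comp_tensorHom_mul rfl rfl]
    simp only [Category.assoc, tensorHom_fst_assoc]
  · rw [Category.assoc, tensorHom_snd]
    apply underlying_hom_ext adj
    · rw [Category.assoc, Category.assoc, Category.assoc, c₂, Category.assoc, tensorHom_snd_assoc,
        ← Functor.map_comp, ← Functor.map_comp, tensorHom_fst, tensorHom_fst]
    -- The multiplication is the sum of the two projections, and L is additive on morphisms into a
    -- monoid object.
    · rw [Category.assoc, Category.assoc, Category.assoc, c₃, Category.assoc, Category.assoc,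
        tensorHom_snd_assoc, tensorHom_snd_assoc,
        ← Functor.map_comp, ← Functor.map_comp, ← Functor.map_comp, tensorHom_mul_snd,
        underlying_map_mul adj, MonObj.comp_mul, MonObj.comp_mul]

theorem trivLift_comm :
    trivLift adj X A ≫ (fst X A ⊗ₘ (underlying Ab).map (fst X A)) =
      fst X A ≫ inl X ((underlying Ab).obj X) := by
  refine CartesianMonoidalCategory.hom_ext _ _ ?_ ?_
  · rw [Category.assoc, Category.assoc, tensorHom_fst, trivLift_fst_assoc, inl_fst, inl_fst]
  · rw [Category.assoc, Category.assoc, tensorHom_snd, trivLift_snd_assoc, inl_snd, etaL_map,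
      inr_fst_assoc, zero_comp, comp_zero, comp_zero]

theorem inl_trivLift : inl X A ≫ trivLift adj X A = inl X A ≫ inl _ _ := by
  refine CartesianMonoidalCategory.hom_ext _ _ ?_ ?_
  · rw [Category.assoc, Category.assoc, trivLift_fst, inl_fst_assoc, inl_fst, Category.comp_id]
  · rw [Category.assoc, Category.assoc, trivLift_snd, inl_snd_assoc, inl_snd, zero_comp,
      comp_zero]

include adj in
theorem inl_tensorHom_map {Y : C} (f : X ⟶ Y) :
    inl X _ ≫ (f ⊗ₘ (underlying Ab).map f) = f ≫ inl Y _ :=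
  inl_tensorHom _ _

theorem inr_trivLift : inr X A ≫ trivLift adj X A = inr X A ≫ etaL adj (X ⊗ A) ≫ inr _ _ := by
  refine CartesianMonoidalCategory.hom_ext _ _ ?_ ?_
  · rw [Category.assoc, Category.assoc, Category.assoc, trivLift_fst, inr_fst_assoc, inr_fst,
      zero_comp, comp_zero, comp_zero]
  · rw [Category.assoc, Category.assoc, Category.assoc, trivLift_snd, inr_snd_assoc, inr_snd,
      Category.comp_id]

/-- On the zero section the lift is the zero tangent vector, and on the fibre it sends a to (0, η(0,
a)). The remaining comparison is naturality of η at the lift itself. -/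
theorem trivLift_trivLift : trivLift adj X A ≫
      (trivLift adj X A ⊗ₘ (underlying Ab).map (trivLift adj X A)) =
    trivLift adj X A ≫ trivLift adj (X ⊗ A) ((underlying Ab).obj (X ⊗ A)) := by
  refine CartesianMonoidalCategory.hom_ext _ _ ?_ ?_
  · rw [Category.assoc, Category.assoc, tensorHom_fst, trivLift_fst_assoc, trivLift_fst,
      inl_trivLift, trivLift_fst_assoc]
  · rw [Category.assoc, Category.assoc, tensorHom_snd, trivLift_snd_assoc, trivLift_snd, etaL_map,
      trivLift_snd_assoc]
    congr 1
    rw [← Category.assoc, inr_trivLift]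
    simp only [Category.assoc]

/-- The components of a sum of a trivial bundle followed by the lift, with values in the additive
structure of the tangent bundle. -/
theorem mul_trivLift : (𝟙 X ⊗ₘ μ[A]) ≫ trivLift adj X A =
    lift (((𝟙 X ⊗ₘ fst A A) ≫ trivLift adj X A) ≫ fst _ _)
      ((((𝟙 X ⊗ₘ fst A A) ≫ trivLift adj X A) ≫ snd _ _) *
        (((𝟙 X ⊗ₘ snd A A) ≫ trivLift adj X A) ≫ snd _ _)) := by
  refine CartesianMonoidalCategory.hom_ext _ _ ?_ ?_
  · rw [lift_fst, Category.assoc, Category.assoc, trivLift_fst, tensorHom_fst_assoc,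
      tensorHom_fst_assoc]
  · rw [lift_snd, Category.assoc, Category.assoc, Category.assoc, trivLift_snd, ← Category.assoc,
      tensorHom_mul_snd, hom_mul_comp, Category.assoc, Category.assoc]

/-- Here `w` stands for the pairing of the two lifts in the pullback T(E₂); this yields the sum
axiom for the lift as a morphism to T(q). -/
theorem comp_mul_trivLift
    {w : X ⊗ (A ⊗ A) ⟶ (X ⊗ (A ⊗ A)) ⊗ (underlying Ab).obj (X ⊗ (A ⊗ A))}
    (h₁ : w ≫ ((𝟙 X ⊗ₘ fst A A) ⊗ₘ (underlying Ab).map (𝟙 X ⊗ₘ fst A A)) =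
      (𝟙 X ⊗ₘ fst A A) ≫ trivLift adj X A)
    (h₂ : w ≫ ((𝟙 X ⊗ₘ snd A A) ⊗ₘ (underlying Ab).map (𝟙 X ⊗ₘ snd A A)) =
      (𝟙 X ⊗ₘ snd A A) ≫ trivLift adj X A) :
    w ≫ ((𝟙 X ⊗ₘ μ[A]) ⊗ₘ (underlying Ab).map (𝟙 X ⊗ₘ μ[A])) =
      (𝟙 X ⊗ₘ μ[A]) ≫ trivLift adj X A := by
  apply comp_tensorHom_map_mul adj h₁ h₂
  · refine CartesianMonoidalCategory.hom_ext _ _ ?_ ?_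
    · simp
    · simp only [Category.assoc, trivLift_fst_assoc, inl_snd, comp_zero, lift_snd, mul_zeroHom]
  · simp only [Category.assoc, trivLift_snd_assoc, etaL_map, inr_fst_assoc, zero_comp, comp_zero]
  · simp only [Category.assoc, trivLift_snd_assoc, etaL_map, inr_snd_assoc]
    rw [← Category.assoc (𝟙 X ⊗ₘ μ[A]), tensorHom_mul_snd, hom_mul_comp, Category.assoc,
      Category.assoc]

/-- The components of `T(σ) ∘ ⟨λ ∘ ρ₁, z ∘ ρ₂⟩` for a trivial bundle. -/
theorem comp_liftSum {w : X ⊗ (A ⊗ A) ⟶ (X ⊗ (A ⊗ A)) ⊗ (underlying Ab).obj (X ⊗ (A ⊗ A))}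
    (h₁ : w ≫ ((𝟙 X ⊗ₘ fst A A) ⊗ₘ (underlying Ab).map (𝟙 X ⊗ₘ fst A A)) =
      (𝟙 X ⊗ₘ fst A A) ≫ trivLift adj X A)
    (h₂ : w ≫ ((𝟙 X ⊗ₘ snd A A) ⊗ₘ (underlying Ab).map (𝟙 X ⊗ₘ snd A A)) =
      (𝟙 X ⊗ₘ snd A A) ≫ inl (X ⊗ A) _) :
    w ≫ ((𝟙 X ⊗ₘ μ[A]) ⊗ₘ (underlying Ab).map (𝟙 X ⊗ₘ μ[A])) =
      lift (𝟙 X ⊗ₘ snd A A) ((𝟙 X ⊗ₘ fst A A) ≫ snd X A ≫ inr X A ≫ etaL adj (X ⊗ A)) := by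
  apply comp_tensorHom_map_mul adj h₁ h₂
  · refine CartesianMonoidalCategory.hom_ext _ _ ?_ ?_
    · simp
    · simp only [Category.assoc, trivLift_fst_assoc, inl_snd, comp_zero, lift_snd, inl_fst_assoc,
        lift_fst, zeroHom_mul]
  · simp only [Category.assoc, trivLift_snd_assoc, etaL_map, inr_fst_assoc, zero_comp, comp_zero,
      lift_snd_assoc]
  · simp only [Category.assoc, trivLift_snd_assoc, etaL_map, inr_snd_assoc, inl_snd_assoc,
      comp_zero, zero_comp, lift_snd_assoc, mul_zeroHom]

end TrivialBundle

/-! ### Universality of the trivial lift -/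

section Universal

variable {C : Type u} [Category.{v} C] [CartesianMonoidalCategory C] [HasZeroMorphisms C]
  [HasFiniteColimits C] [StronglyUnital C] [Regular C] [BraidedCategory C]
  {Ab : C ⥤ CommGrp C} (adj : Ab ⊣ CommGrp.forget C)

/-- The universality of the lift of a trivial bundle is preserved by every product preserving
functor. -/
theorem isPullback_trivLift (F : C ⥤ C) [PreservesFiniteProducts F] (X : C) (A : CommGrp C) :
    IsPullback
      (F.map (lift (𝟙 X ⊗ₘ snd A.X A.X)
        ((𝟙 X ⊗ₘ fst A.X A.X) ≫ snd X A.X ≫ inr X A.X ≫ etaL adj (X ⊗ A.X))))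
      (F.map ((𝟙 X ⊗ₘ fst A.X A.X) ≫ fst X A.X))
      (F.map (fst X A.X ⊗ₘ (underlying Ab).map (fst X A.X)))
      (F.map (inl X ((underlying Ab).obj X))) := by
  have := underlying_preservesFiniteProducts adj
  set top := lift (𝟙 X ⊗ₘ snd A.X A.X)
    ((𝟙 X ⊗ₘ fst A.X A.X) ≫ snd X A.X ≫ inr X A.X ≫ etaL adj (X ⊗ A.X)) with htop
  have t₁ : top ≫ fst _ _ ≫ fst _ _ = fst _ _ := by simp [htop]
  have t₂ : top ≫ fst _ _ ≫ snd _ _ = snd _ _ ≫ snd _ _ := by simp [htop]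
  have t₃ : top ≫ snd _ _ ≫ (underlying Ab).map (fst X A.X) =
      fst _ _ ≫ inl X ((underlying Ab).obj X) ≫ snd _ _ := by
    simp only [htop, Category.assoc, lift_snd_assoc, etaL_map, inr_fst_assoc, zero_comp,
      comp_zero, inl_snd]
  have t₄ : top ≫ snd _ _ ≫ (underlying Ab).map (snd X A.X) =
      snd _ _ ≫ fst _ _ ≫ etaL adj A.X := by
    simp only [htop, Category.assoc, lift_snd_assoc, etaL_map, inr_snd_assoc, tensorHom_snd_assoc]
  have hq : (𝟙 X ⊗ₘ fst A.X A.X) ≫ fst X A.X = fst _ _ := by simp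
  rw [hq]
  clear_value top
  have w : top ≫ (fst X A.X ⊗ₘ (underlying Ab).map (fst X A.X)) =
      fst _ _ ≫ inl X ((underlying Ab).obj X) := by
    refine CartesianMonoidalCategory.hom_ext _ _ ?_ ?_
    · rw [Category.assoc, tensorHom_fst, t₁, Category.assoc, inl_fst, Category.comp_id]
    · rw [Category.assoc, tensorHom_snd, t₃, Category.assoc]
  -- A cone amounts to x together with ((x, a), t), where t in L(X × A) has zero component in L(X).
  -- Its lift is (x, (b, a)), with b recovered from the component of t in L(A) through the inverse
  -- of η, which exists because A is an abelian group object.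
  refine ⟨⟨by rw [← F.map_comp, ← F.map_comp, w]⟩, ⟨PullbackCone.IsLimit.mk _
    (fun s => mapLift F s.snd (mapLift F
      (s.fst ≫ F.map (snd _ _ ≫ (underlying Ab).map (snd X A.X) ≫ inv (etaL adj A.X)))
      (s.fst ≫ F.map (fst _ _ ≫ snd _ _))))
    (fun s => ?_) (fun s => mapLift_fst _ _ _) (fun s m h₁ h₂ => ?_)⟩⟩
  · have e₁ : s.fst ≫ F.map (fst _ _ ≫ fst _ _) = s.snd := by
      have := s.condition =≫ F.map (fst _ _)
      rw [Category.assoc, Category.assoc, ← F.map_comp, ← F.map_comp, tensorHom_fst, inl_fst,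
        F.map_id, Category.comp_id] at this
      exact this
    have e₂ : s.fst ≫ F.map (snd _ _ ≫ (underlying Ab).map (fst X A.X)) =
        s.snd ≫ F.map (inl X ((underlying Ab).obj X) ≫ snd _ _) := by
      have := s.condition =≫ F.map (snd _ _)
      rw [Category.assoc, Category.assoc, ← F.map_comp, ← F.map_comp, tensorHom_snd] at this
      exact this
    have p₁ : ∀ {W Y : C} (a : W ⟶ F.obj (X ⊗ (A.X ⊗ A.X))) (f : _ ⟶ Y) , (a ≫ F.map top) ≫ F.map f
      = a ≫ F.map (top ≫ f) := by
        intros; rw [Category.assoc, F.map_comp]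
    -- The tangent coordinates lie in the image of L(X × A), so they are separated by the product
    -- preserving composite of L and `F`.
    refine map_prod_hom_ext F (map_prod_hom_ext F ?_ ?_)
      (map_prod_hom_ext ((underlying Ab) ⋙ F) ?_ ?_)
    · rw [p₁, Category.assoc, Category.assoc, ← F.map_comp, ← F.map_comp, Category.assoc, t₁, e₁,
        mapLift_fst]
    · rw [p₁, Category.assoc, Category.assoc, ← F.map_comp, ← F.map_comp, Category.assoc, t₂,
        F.map_comp (snd X (A.X ⊗ A.X)), mapLift_snd_assoc, mapLift_snd]
    · rw [p₁, Functor.comp_map, Category.assoc, Category.assoc, ← F.map_comp, ← F.map_comp,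
        Category.assoc, t₃, F.map_comp (fst X (A.X ⊗ A.X)), mapLift_fst_assoc, e₂]
    · rw [p₁, Functor.comp_map, Category.assoc, Category.assoc, ← F.map_comp, ← F.map_comp,
        Category.assoc, t₄, F.map_comp (snd X (A.X ⊗ A.X)), mapLift_snd_assoc,
        F.map_comp (fst A.X A.X), mapLift_fst_assoc,
        Category.assoc, ← F.map_comp, Category.assoc, Category.assoc, IsIso.inv_hom_id,
        Category.comp_id]
  · refine map_prod_hom_ext F ?_ (map_prod_hom_ext F ?_ ?_)
    · rw [mapLift_fst, h₂]
    · rw [mapLift_snd, mapLift_fst, ← h₁, Category.assoc, Category.assoc, ← F.map_comp,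
        ← F.map_comp, reassoc_of% t₄, IsIso.hom_inv_id, Category.comp_id]
    · rw [mapLift_snd, mapLift_snd, ← h₁, Category.assoc, Category.assoc, ← F.map_comp,
        ← F.map_comp, t₂]

end Universal

end TangentCat

end
noncomputable section

set_option linter.unusedSectionVars false

namespace TangentCat

/-! ### The canonical flip in coordinates -/

section Flip

variable {C : Type u} [Category.{v} C] [CartesianMonoidalCategory C] [HasZeroMorphisms C]
  [HasFiniteColimits C] [StronglyUnital C] [Regular C] [BraidedCategory C]
  {Ab : C ⥤ CommGrp C} (adj : Ab ⊣ CommGrp.forget C)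

section

variable (h : IsAdditiveAssignment Ab (abNu adj)) (X : C)

/-- This and the next three projection formulas determine the flip and serve as rewriting rules, so
that ω and its inverse need not be unfolded again. -/
theorem canFlip_fst_fst : h.canFlip X ≫ fst _ _ ≫ fst _ _ = fst _ _ ≫ fst _ _ := by
  simp [IsAdditiveAssignment.canFlip, interchange]

theorem canFlip_fst_fst_assoc {W : C} (k : _ ⟶ W) :
    h.canFlip X ≫ fst _ _ ≫ fst _ _ ≫ k = fst _ _ ≫ fst _ _ ≫ k := by
  simpa only [Category.assoc, Category.id_comp] using canFlip_fst_fst adj h X =≫ k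

theorem canFlip_fst_snd :
    h.canFlip X ≫ fst _ _ ≫ snd _ _ = snd _ _ ≫ (underlying Ab).map (fst _ _) := by
  simp [IsAdditiveAssignment.canFlip, interchange, IsAdditiveAssignment.omega]

theorem canFlip_fst_snd_assoc {W : C} (k : _ ⟶ W) :
    h.canFlip X ≫ fst _ _ ≫ snd _ _ ≫ k =
      snd _ _ ≫ (underlying Ab).map (fst _ _) ≫ k := by
  simpa only [Category.assoc, Category.id_comp] using canFlip_fst_snd adj h X =≫ k

theorem canFlip_snd_fst :
    h.canFlip X ≫ snd _ _ ≫ (underlying Ab).map (fst _ _) = fst _ _ ≫ snd _ _ := by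
  have := h.preservesFiniteProducts
  simp [IsAdditiveAssignment.canFlip, interchange, IsAdditiveAssignment.omegaInv]

theorem canFlip_snd_fst_assoc {W : C} (k : _ ⟶ W) :
    h.canFlip X ≫ snd _ _ ≫ (underlying Ab).map (fst _ _) ≫ k =
      fst _ _ ≫ snd _ _ ≫ k := by
  simpa only [Category.assoc, Category.id_comp] using canFlip_snd_fst adj h X =≫ k

theorem canFlip_snd_snd :
    h.canFlip X ≫ snd _ _ ≫ (underlying Ab).map (snd _ _) =
      snd _ _ ≫ (underlying Ab).map (snd _ _) := by
  have := h.preservesFiniteProducts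
  simp [IsAdditiveAssignment.canFlip, interchange, IsAdditiveAssignment.omegaInv,
    IsAdditiveAssignment.omega]

theorem canFlip_snd_snd_assoc {W : C} (k : _ ⟶ W) :
    h.canFlip X ≫ snd _ _ ≫ (underlying Ab).map (snd _ _) ≫ k =
      snd _ _ ≫ (underlying Ab).map (snd _ _) ≫ k := by
  simpa only [Category.assoc, Category.id_comp] using canFlip_snd_snd adj h X =≫ k

theorem map_canFlip_fst_fst :
    (underlying Ab).map (h.canFlip X) ≫ (underlying Ab).map (fst _ _) ≫
      (underlying Ab).map (fst _ _) =
    (underlying Ab).map (fst _ _) ≫ (underlying Ab).map (fst _ _) := by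
  rw [← Functor.map_comp, ← Functor.map_comp, canFlip_fst_fst, Functor.map_comp]

theorem map_canFlip_fst_snd :
    (underlying Ab).map (h.canFlip X) ≫ (underlying Ab).map (fst _ _) ≫
      (underlying Ab).map (snd _ _) =
    (underlying Ab).map (snd _ _) ≫ (underlying Ab).map ((underlying Ab).map (fst _ _)) := by
  rw [← Functor.map_comp, ← Functor.map_comp, canFlip_fst_snd, Functor.map_comp]

theorem map_canFlip_snd_fst :
    (underlying Ab).map (h.canFlip X) ≫ (underlying Ab).map (snd _ _) ≫
      (underlying Ab).map ((underlying Ab).map (fst _ _)) =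
    (underlying Ab).map (fst _ _) ≫ (underlying Ab).map (snd _ _) := by
  rw [← Functor.map_comp, ← Functor.map_comp, canFlip_snd_fst, Functor.map_comp]

theorem map_canFlip_snd_snd :
    (underlying Ab).map (h.canFlip X) ≫ (underlying Ab).map (snd _ _) ≫
      (underlying Ab).map ((underlying Ab).map (snd _ _)) =
    (underlying Ab).map (snd _ _) ≫ (underlying Ab).map ((underlying Ab).map (snd _ _)) := by
  rw [← Functor.map_comp, ← Functor.map_comp, canFlip_snd_snd, Functor.map_comp]

end

include adj in
theorem tangent_hom_ext {X Y Z : C} {f g : Z ⟶ (X ⊗ Y) ⊗ (underlying Ab).obj (X ⊗ Y)}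
    (h₁ : f ≫ fst _ _ ≫ fst _ _ = g ≫ fst _ _ ≫ fst _ _)
    (h₂ : f ≫ fst _ _ ≫ snd _ _ = g ≫ fst _ _ ≫ snd _ _)
    (h₃ : f ≫ snd _ _ ≫ (underlying Ab).map (fst _ _) =
      g ≫ snd _ _ ≫ (underlying Ab).map (fst _ _))
    (h₄ : f ≫ snd _ _ ≫ (underlying Ab).map (snd _ _) =
      g ≫ snd _ _ ≫ (underlying Ab).map (snd _ _)) : f = g := by
  refine CartesianMonoidalCategory.hom_ext _ _ (CartesianMonoidalCategory.hom_ext _ _ ?_ ?_)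
    (underlying_hom_ext adj ?_ ?_)
  all_goals simpa only [Category.assoc]

-- Supplies the tangent half of the eight coordinates of TTT(X); the last two are separated because
-- L followed by L preserves products.
include adj in
theorem underlying_tangent_hom_ext {X Y Z : C}
    {f g : Z ⟶ (underlying Ab).obj ((X ⊗ Y) ⊗ (underlying Ab).obj (X ⊗ Y))}
    (h₁ : f ≫ (underlying Ab).map (fst _ _) ≫ (underlying Ab).map (fst _ _) =
      g ≫ (underlying Ab).map (fst _ _) ≫ (underlying Ab).map (fst _ _))
    (h₂ : f ≫ (underlying Ab).map (fst _ _) ≫ (underlying Ab).map (snd _ _) =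
      g ≫ (underlying Ab).map (fst _ _) ≫ (underlying Ab).map (snd _ _))
    (h₃ : f ≫ (underlying Ab).map (snd _ _) ≫ (underlying Ab).map ((underlying Ab).map (fst _ _)) =
      g ≫ (underlying Ab).map (snd _ _) ≫ (underlying Ab).map ((underlying Ab).map (fst _ _)))
    (h₄ : f ≫ (underlying Ab).map (snd _ _) ≫ (underlying Ab).map ((underlying Ab).map (snd _ _)) =
      g ≫ (underlying Ab).map (snd _ _) ≫ (underlying Ab).map ((underlying Ab).map (snd _ _))) :
    f = g := by
  have := underlying_preservesFiniteProducts adj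
  refine underlying_hom_ext adj (underlying_hom_ext adj ?_ ?_)
    (map_prod_hom_ext (underlying Ab ⋙ underlying Ab) ?_ ?_)
  all_goals simpa only [Category.assoc]

section

variable (h : IsAdditiveAssignment Ab (abNu adj)) (X : C)

theorem canFlip_canFlip : h.canFlip X ≫ h.canFlip X = 𝟙 _ := by
  apply tangent_hom_ext adj <;>
  simp only [Category.assoc, Category.id_comp, canFlip_fst_fst, canFlip_fst_snd, canFlip_snd_fst,
    canFlip_snd_snd]

/-- Both composites permute the eight coordinates of TTT(X) in the same way. -/
theorem canFlip_yangBaxter :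
    (h.canFlip X ⊗ₘ (underlying Ab).map (h.canFlip X)) ≫
      h.canFlip (X ⊗ (underlying Ab).obj X) ≫
        (h.canFlip X ⊗ₘ (underlying Ab).map (h.canFlip X)) =
    h.canFlip (X ⊗ (underlying Ab).obj X) ≫
      (h.canFlip X ⊗ₘ (underlying Ab).map (h.canFlip X)) ≫
        h.canFlip (X ⊗ (underlying Ab).obj X) := by
  refine CartesianMonoidalCategory.hom_ext _ _ (tangent_hom_ext adj ?_ ?_ ?_ ?_)
    (underlying_tangent_hom_ext adj ?_ ?_ ?_ ?_)
  all_goals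
    simp only [Category.assoc, canFlip_fst_fst, canFlip_fst_snd, canFlip_snd_fst,
      canFlip_snd_snd, canFlip_fst_fst_assoc, canFlip_fst_snd_assoc, canFlip_snd_fst_assoc,
      canFlip_snd_snd_assoc, map_canFlip_fst_fst, map_canFlip_fst_snd, map_canFlip_snd_fst,
      map_canFlip_snd_snd, tensorHom_fst, tensorHom_snd,
      tensorHom_fst_assoc, tensorHom_snd_assoc]

theorem trivLift_snd_map_fst (A : C) :
    trivLift adj X A ≫ snd _ _ ≫ (underlying Ab).map (fst X A) = 0 := by
  rw [trivLift_snd_assoc, etaL_map, inr_fst_assoc, zero_comp, comp_zero]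

theorem trivLift_snd_map_fst_assoc (A : C) {W : C} (k : (underlying Ab).obj X ⟶ W) :
    trivLift adj X A ≫ snd _ _ ≫ (underlying Ab).map (fst X A) ≫ k = 0 ≫ k := by
  simpa only [Category.assoc, Category.id_comp] using trivLift_snd_map_fst adj X A =≫ k

theorem trivLift_snd_map_snd (A : C) :
    trivLift adj X A ≫ snd _ _ ≫ (underlying Ab).map (snd X A) = snd X A ≫ etaL adj A := by
  rw [trivLift_snd_assoc, etaL_map, inr_snd_assoc]

theorem trivLift_snd_map_snd_assoc (A : C) {W : C} (k : (underlying Ab).obj A ⟶ W) :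
    trivLift adj X A ≫ snd _ _ ≫ (underlying Ab).map (snd X A) ≫ k =
      snd X A ≫ etaL adj A ≫ k := by
  simpa only [Category.assoc, Category.id_comp] using trivLift_snd_map_snd adj X A =≫ k

theorem map_trivLift_fst (A : C) :
    (underlying Ab).map (trivLift adj X A) ≫ (underlying Ab).map (fst _ _) =
      (underlying Ab).map (fst X A) ≫ (underlying Ab).map (inl X A) := by
  rw [← Functor.map_comp, trivLift_fst, Functor.map_comp]

theorem map_trivLift_fst_assoc (A : C) {W : C} (k : (underlying Ab).obj (X ⊗ A) ⟶ W) :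
    (underlying Ab).map (trivLift adj X A) ≫ (underlying Ab).map (fst _ _) ≫ k =
      (underlying Ab).map (fst X A) ≫ (underlying Ab).map (inl X A) ≫ k := by
  simpa only [Category.assoc, Category.id_comp] using map_trivLift_fst adj X A =≫ k

theorem map_trivLift_snd_fst (A : C) :
    (underlying Ab).map (trivLift adj X A) ≫ (underlying Ab).map (snd _ _) ≫
      (underlying Ab).map ((underlying Ab).map (fst X A)) = 0 := by
  rw [← Functor.map_comp, ← Functor.map_comp, trivLift_snd_map_fst, underlying_map_zero adj]

/-- The identity L(η) = ηL enters here; it is the one fact beyond naturality needed for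
compatibility of the lift with the flip. -/
theorem map_trivLift_snd_snd (A : C) :
    (underlying Ab).map (trivLift adj X A) ≫ (underlying Ab).map (snd _ _) ≫
      (underlying Ab).map ((underlying Ab).map (snd X A)) =
    (underlying Ab).map (snd X A) ≫ etaL adj ((underlying Ab).obj A) := by
  rw [← Functor.map_comp, ← Functor.map_comp, trivLift_snd_map_snd, Functor.map_comp,
    underlying_map_etaL]

include adj in
theorem map_inl_fst (A : C) :
    (underlying Ab).map (inl X A) ≫ (underlying Ab).map (fst X A) = 𝟙 _ := by
  rw [← Functor.map_comp, inl_fst, CategoryTheory.Functor.map_id]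

include adj in
theorem map_inl_snd (A : C) :
    (underlying Ab).map (inl X A) ≫ (underlying Ab).map (snd X A) = 0 := by
  rw [← Functor.map_comp, inl_snd, underlying_map_zero adj]

theorem trivLift_canFlip :
    trivLift adj X ((underlying Ab).obj X) ≫ h.canFlip X =
      trivLift adj X ((underlying Ab).obj X) := by
  apply tangent_hom_ext adj <;>
  simp only [Category.assoc, canFlip_fst_fst, canFlip_fst_snd, canFlip_snd_fst, canFlip_snd_snd,
    trivLift_fst_assoc, trivLift_snd_map_fst, trivLift_snd_map_snd, inl_snd, comp_zero]

theorem trivLift_map_canFlip :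
    trivLift adj (X ⊗ (underlying Ab).obj X) _ ≫
      (h.canFlip X ⊗ₘ (underlying Ab).map (h.canFlip X)) ≫
        h.canFlip (X ⊗ (underlying Ab).obj X) =
    h.canFlip X ≫ (trivLift adj X ((underlying Ab).obj X) ⊗ₘ
      (underlying Ab).map (trivLift adj X ((underlying Ab).obj X))) := by
  refine CartesianMonoidalCategory.hom_ext _ _ (tangent_hom_ext adj ?_ ?_ ?_ ?_)
    (underlying_tangent_hom_ext adj ?_ ?_ ?_ ?_)
  all_goals
    simp only [Category.assoc, canFlip_fst_fst, canFlip_fst_snd, canFlip_snd_fst,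
      canFlip_snd_snd, canFlip_fst_fst_assoc, canFlip_fst_snd_assoc, canFlip_snd_fst_assoc,
      canFlip_snd_snd_assoc, map_canFlip_fst_fst, map_canFlip_fst_snd, map_canFlip_snd_fst,
      map_canFlip_snd_snd, tensorHom_fst, tensorHom_snd,
      tensorHom_fst_assoc, tensorHom_snd_assoc, trivLift_fst_assoc,
      trivLift_snd_map_fst, trivLift_snd_map_snd, trivLift_snd_map_fst_assoc,
      trivLift_snd_map_snd_assoc, map_trivLift_fst_assoc, map_trivLift_snd_fst,
      map_trivLift_snd_snd, inl_fst_assoc, inl_snd_assoc, inl_fst, inl_snd, etaL_map, zero_comp,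
      comp_zero, Category.comp_id, map_inl_fst adj, map_inl_snd adj]

theorem tensorHom_inl_canFlip :
    (inl X ((underlying Ab).obj X) ⊗ₘ (underlying Ab).map (inl X ((underlying Ab).obj X))) ≫
      h.canFlip X = inl (X ⊗ (underlying Ab).obj X) _ := by
  apply tangent_hom_ext adj <;>
  simp only [Category.assoc, canFlip_fst_fst, canFlip_fst_snd, canFlip_snd_fst, canFlip_snd_snd,
    tensorHom_fst_assoc, tensorHom_snd_assoc, map_inl_fst adj, map_inl_snd adj, inl_fst,
    inl_snd, inl_fst_assoc, inl_snd_assoc, zero_comp, comp_zero, Category.comp_id]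

/-- The flip turns the vector coordinate of the base into a tangent coordinate, so T applied to the
sum becomes the sum of tangent vectors. The last coordinate uses additivity of L on morphisms. -/
theorem tensorHom_mul_canFlip :
    ((𝟙 X ⊗ₘ μ[(underlying Ab).obj X]) ⊗ₘ
        (underlying Ab).map (𝟙 X ⊗ₘ μ[(underlying Ab).obj X])) ≫ h.canFlip X =
      lift ((((𝟙 X ⊗ₘ fst _ _) ⊗ₘ (underlying Ab).map (𝟙 X ⊗ₘ fst _ _)) ≫ h.canFlip X) ≫ fst _ _)
        (((((𝟙 X ⊗ₘ fst _ _) ⊗ₘ (underlying Ab).map (𝟙 X ⊗ₘ fst _ _)) ≫ h.canFlip X) ≫ snd _ _) *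
          ((((𝟙 X ⊗ₘ snd _ _) ⊗ₘ (underlying Ab).map (𝟙 X ⊗ₘ snd _ _)) ≫ h.canFlip X) ≫
            snd _ _)) := by
  apply tangent_hom_ext adj
  · simp only [Category.assoc, canFlip_fst_fst, lift_fst_assoc, tensorHom_fst_assoc, tensorHom_fst]
  · simp only [Category.assoc, canFlip_fst_snd, lift_fst_assoc, tensorHom_snd_assoc,
      ← Functor.map_comp, tensorHom_fst]
  · rw [lift_snd_assoc, hom_mul_comp]
    simp only [Category.assoc, canFlip_snd_fst, tensorHom_fst_assoc]
    rw [tensorHom_mul_snd, MonObj.comp_mul]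
  · rw [lift_snd_assoc, hom_mul_comp]
    simp only [Category.assoc, canFlip_snd_snd, tensorHom_snd_assoc, ← Functor.map_comp]
    rw [tensorHom_mul_snd, underlying_map_mul adj, MonObj.comp_mul]

end

end Flip

end TangentCat

end
noncomputable section

set_option linter.unusedSectionVars false

namespace TangentCat

/-! ### The tangent structure and the trivial differential bundles -/

section TangentStructure

variable {C : Type u} [Category.{v} C] [CartesianMonoidalCategory C] [HasZeroMorphisms C]
  [HasFiniteColimits C] [StronglyUnital C] [Regular C] [BraidedCategory C]
  {Ab : C ⥤ CommGrp C} (adj : Ab ⊣ CommGrp.forget C) (h : IsAdditiveAssignment Ab (abNu adj))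

include adj in
theorem prodFunctor_preservesFiniteProducts :
    PreservesFiniteProducts (prodFunctor (𝟭 C) (underlying Ab)) := by
  have := underlying_preservesFiniteProducts adj
  have h₁ : ∀ X Y : C, IsIso (CartesianMonoidalCategory.prodComparison
      (prodFunctor (𝟭 C) (underlying Ab)) X Y) := by
    intro X Y
    have e : CartesianMonoidalCategory.prodComparison (prodFunctor (𝟭 C) (underlying Ab)) X Y =
        lift (fst X Y ⊗ₘ (underlying Ab).map (fst X Y))
          (snd X Y ⊗ₘ (underlying Ab).map (snd X Y)) := rfl
    let i : (X ⊗ (underlying Ab).obj X) ⊗ (Y ⊗ (underlying Ab).obj Y) ⟶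
        (X ⊗ Y) ⊗ (underlying Ab).obj (X ⊗ Y) :=
      lift (fst _ _ ⊗ₘ fst _ _) (mapLift _ (fst _ _ ≫ snd _ _) (snd _ _ ≫ snd _ _))
    refine ⟨i, ?_, ?_⟩
    · refine (e =≫ i).trans (tangent_hom_ext adj ?_ ?_ ?_ ?_) <;> simp [i, prodFunctor]
    · have e' : i ≫ lift (fst X Y ⊗ₘ (underlying Ab).map (fst X Y))
          (snd X Y ⊗ₘ (underlying Ab).map (snd X Y)) =
            𝟙 ((X ⊗ (underlying Ab).obj X) ⊗ (Y ⊗ (underlying Ab).obj Y)) := by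
        ext <;> simp [i]
      exact (i ≫= e).trans e'
  have h₂ : IsIso (CartesianMonoidalCategory.terminalComparison
      (prodFunctor (𝟭 C) (underlying Ab))) := by
    refine ⟨0, ?_, toUnit_unique _ _⟩
    rw [comp_zero]
    -- The terminal object has zero identity and L preserves zero morphisms, so L(1), and hence
    -- T(1), is a zero object.
    have e : 𝟙 (𝟙_ C ⊗ (underlying Ab).obj (𝟙_ C)) = 0 := by
      refine CartesianMonoidalCategory.hom_ext _ _ (toUnit_unique _ _) ?_
      · rw [zero_comp, Category.id_comp, ← Category.comp_id (snd _ _),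
          ← CategoryTheory.Functor.map_id, hom_from_unit (𝟙 (𝟙_ C)), underlying_map_zero adj,
          comp_zero]
    exact e.symm
  have := preservesLimitsOfShape_discrete_walkingPair_of_isIso_prodComparison
    (prodFunctor (𝟭 C) (underlying Ab))
  have := preservesLimit_empty_of_isIso_terminalComparison (prodFunctor (𝟭 C) (underlying Ab))
  have : PreservesLimitsOfShape (Discrete PEmpty.{1}) (prodFunctor (𝟭 C) (underlying Ab)) :=
    preservesLimitsOfShape_pempty_of_preservesTerminal _
  exact PreservesFiniteProducts.of_preserves_binary_and_terminal _

theorem iter_preservesFiniteProducts (F : C ⥤ C) [PreservesFiniteProducts F] (m : ℕ) :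
    PreservesFiniteProducts (iter F m) := by
  induction m with
  | zero => exact inferInstanceAs (PreservesFiniteProducts (𝟭 C))
  | succ m ih => exact inferInstanceAs (PreservesFiniteProducts (iter F m ⋙ F))

theorem iter_preservesPowers (X A : C) (m : ℕ) :
    PreservesPowers (iter h.tangentData.T m) (fst X A) :=
  haveI : PreservesFiniteProducts h.tangentData.T := prodFunctor_preservesFiniteProducts adj
  haveI := iter_preservesFiniteProducts h.tangentData.T m
  preservesPowers_fst _ _ _

theorem tangent_preservesPowers (X A : C) : PreservesPowers h.tangentData.T (fst X A) :=
  (iter_preservesPowers adj h X A 1).of_iter_one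

theorem tangent_z_app (X : C) : h.tangentData.z.app X = inl X ((underlying Ab).obj X) :=
  zeroSec_eq Ab X

theorem tangent_l_app (X : C) :
    h.tangentData.l.app X = trivLift adj X ((underlying Ab).obj X) :=
  vertLift_eq adj h X

section

variable {X A : C} [GrpObj A] (hp : PreservesPowers h.tangentData.T (prodBundle X A).q)
  {lam : X ⊗ A ⟶ (X ⊗ A) ⊗ (underlying Ab).obj (X ⊗ A)} (e : lam = trivLift adj X A)

include e

theorem isAdditiveHom_trivLift :
    BundleData.IsAdditiveHom (prodBundle X A) ((prodBundle X A).map h.tangentData.T hp) lam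
      (h.tangentData.z.app X) where
  comm := by
    subst e
    exact (trivLift_comm adj).trans (fst X A ≫= (tangent_z_app adj h X).symm)
  sum := by
    subst e
    exact (comp_mul_trivLift adj (IsPullback.lift_fst _ _ _ _) (IsPullback.lift_snd _ _ _ _)).symm
  zero := by
    subst e
    have h₁ := (lift_unit_eq X A =≫ trivLift adj X A).trans (inl_trivLift adj)
    refine h₁.trans ((inl_tensorHom_map adj (inl X A)).symm.trans ?_)
    refine congr (congrArg _ (tangent_z_app adj h X).symm) ?_
    exact congrArg h.tangentData.T.map (lift_unit_eq X A).symm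

theorem isAdditiveHom_trivLift_bundle :
    BundleData.IsAdditiveHom (prodBundle X A) (h.tangentData.bundle (X ⊗ A)) lam
      (prodBundle X A).zero where
  comm := by
    subst e
    exact (trivLift_fst adj X A).trans (fst X A ≫= (lift_unit_eq X A).symm)
  sum := by
    subst e
    exact (mul_trivLift adj).trans (prodBundle_pair_sum _ _ _).symm
  zero := by
    subst e
    refine (lift_unit_eq X A =≫ trivLift adj X A).trans ((inl_trivLift adj).trans ?_)
    exact congr (congrArg _ (lift_unit_eq X A).symm) (tangent_z_app adj h _).symm

theorem liftSum_trivLift (hc : lam ≫ h.tangentData.T.map (prodBundle X A).q =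
      (prodBundle X A).q ≫ h.tangentData.z.app X) :
    h.tangentData.liftSum (prodBundle X A) hp lam hc =
      lift (𝟙 X ⊗ₘ snd A A) ((𝟙 X ⊗ₘ fst A A) ≫ snd X A ≫ inr X A ≫ etaL adj (X ⊗ A)) := by
  subst e
  exact comp_liftSum adj (IsPullback.lift_fst _ _ _ _)
    ((IsPullback.lift_snd _ _ _ _).trans ((𝟙 X ⊗ₘ snd A A) ≫= tangent_z_app adj h _))

end

theorem isPullback_liftSum (F : C ⥤ C) [PreservesFiniteProducts F] (X : C) (A : CommGrp C)
    (hp : PreservesPowers h.tangentData.T (prodBundle X A.X).q)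
    {lam : X ⊗ A.X ⟶ (X ⊗ A.X) ⊗ (underlying Ab).obj (X ⊗ A.X)}
    (e : lam = trivLift adj X A.X)
    (hc : lam ≫ h.tangentData.T.map (prodBundle X A.X).q =
      (prodBundle X A.X).q ≫ h.tangentData.z.app X) :
    IsPullback (F.map (h.tangentData.liftSum (prodBundle X A.X) hp lam hc))
      (F.map ((prodBundle X A.X).ρ₁ ≫ (prodBundle X A.X).q))
      (F.map (h.tangentData.T.map (prodBundle X A.X).q)) (F.map (h.tangentData.z.app X)) := by
  have := isPullback_trivLift adj F X A
  rw [liftSum_trivLift adj h hp e hc, tangent_z_app adj h X]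
  exact this

/-- The tangent bundle of X unfolds definitionally to the trivial bundle with fibre L(X). Only the
flip axioms are specific to this fibre. -/
theorem tangentData_isTangentStructure :
    h.tangentData.toTangentData.IsTangentStructure where
  additive X := prodBundle_isAdditive (X := X) (A := (underlying Ab).obj X)
  preserves m X := iter_preservesPowers adj h X _ m
  lift_additive X := isAdditiveHom_trivLift adj h _ (tangent_l_app adj h X)
  lift_lift X := by
    rw [tangent_l_app, tangent_l_app]
    exact (trivLift_trivLift adj).symm
  lift_universal X := isPullback_liftSum adj h (𝟭 C) X (Ab.obj X)
    (tangent_preservesPowers adj h X _) (tangent_l_app adj h X)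
    (isAdditiveHom_trivLift adj h (tangent_preservesPowers adj h X _) (tangent_l_app adj h X)).comm
  flip_flip X := canFlip_canFlip adj h X
  yang_baxter X := canFlip_yangBaxter adj h X
  flip_additive X :=
    { comm := by
        refine Eq.trans ?_ (Category.comp_id _).symm
        change h.canFlip X ≫ fst _ _ = (fst _ _ ⊗ₘ (underlying Ab).map (fst _ _))
        refine CartesianMonoidalCategory.hom_ext _ _ ?_ ?_
        · rw [Category.assoc, canFlip_fst_fst, tensorHom_fst]
        · rw [Category.assoc, canFlip_fst_snd, tensorHom_snd]
      sum := (tensorHom_mul_canFlip adj h X).trans (prodBundle_pair_sum _ _ _).symm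
      zero := by
        refine Eq.trans ?_ (Category.id_comp _).symm
        change (IsAdditiveAssignment.zeroSec Ab X ⊗ₘ
          (underlying Ab).map (IsAdditiveAssignment.zeroSec Ab X)) ≫ h.canFlip X =
            IsAdditiveAssignment.zeroSec Ab (X ⊗ (underlying Ab).obj X)
        rw [zeroSec_eq, zeroSec_eq]
        exact tensorHom_inl_canFlip adj h X }
  lift_flip X := by
    rw [tangent_l_app]
    exact trivLift_canFlip adj h X
  flip_lift X := by
    rw [tangent_l_app, tangent_l_app]
    exact trivLift_map_canFlip adj h X

theorem negMor_eq_inv (X : C) : negMor Ab X = (𝟙 ((underlying Ab).obj X))⁻¹ :=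
  GrpObj.inv_eq_inv

theorem lift_mul_negMor (X : C) :
    lift (𝟙 _ ≫ fst X ((underlying Ab).obj X))
      ((𝟙 _ ≫ snd X _) * ((𝟙 X ⊗ₘ negMor Ab X) ≫ snd X _)) = fst X _ ≫ inl X _ := by
  rw [tensorHom_snd, Category.id_comp, Category.id_comp, negMor_eq_inv, GrpObj.comp_inv,
    Category.comp_id, mul_inv_cancel, hom_one_eq_zero]
  ext <;> simp

theorem lift_negMor_mul (X : C) :
    lift ((𝟙 X ⊗ₘ negMor Ab X) ≫ fst X ((underlying Ab).obj X))
      (((𝟙 X ⊗ₘ negMor Ab X) ≫ snd X _) * (𝟙 _ ≫ snd X _)) = fst X _ ≫ inl X _ := by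
  rw [tensorHom_snd, tensorHom_fst, Category.id_comp, negMor_eq_inv, GrpObj.comp_inv,
    Category.comp_id, Category.comp_id, inv_mul_cancel, hom_one_eq_zero]
  ext <;> simp

theorem tangentData_isCartesianRosicky : h.tangentData.IsCartesianRosicky where
  toIsTangentStructure := tangentData_isTangentStructure adj h
  neg_p X := (tensorHom_fst _ _).trans (Category.comp_id _)
  sum_neg X := by
    refine (prodBundle_pair_sum _ _ _).trans ?_
    exact (lift_mul_negMor X).trans (fst X _ ≫= (tangent_z_app adj h X).symm)
  neg_sum X := by
    refine (prodBundle_pair_sum _ _ _).trans ?_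
    exact (lift_negMor_mul X).trans (fst X _ ≫= (tangent_z_app adj h X).symm)
  preservesFiniteProducts := prodFunctor_preservesFiniteProducts adj

/-- The trivial differential bundle `X × A ⟶ X` with fibre an abelian group object `A`. -/
def trivBundle (X : C) (A : CommGrp C) : DiffBundle h.tangentData.toTangentData X where
  toBundleData := prodBundle X A.X
  additive := prodBundle_isAdditive
  preserves m := iter_preservesPowers adj h X A.X m
  lam := trivLift adj X A.X
  lam_additive_zero := isAdditiveHom_trivLift adj h _ rfl
  lam_additive := isAdditiveHom_trivLift_bundle adj h rfl
  lam_lam := by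
    rw [tangent_l_app]
    exact trivLift_trivLift adj
  universal := isPullback_liftSum adj h (𝟭 C) X A (tangent_preservesPowers adj h X A.X) rfl
    (isAdditiveHom_trivLift adj h (tangent_preservesPowers adj h X A.X) rfl).comm
  preserves_universal m :=
    haveI : PreservesFiniteProducts h.tangentData.T := prodFunctor_preservesFiniteProducts adj
    haveI := iter_preservesFiniteProducts h.tangentData.T m
    isPullback_liftSum adj h _ X A (tangent_preservesPowers adj h X A.X) rfl
      (isAdditiveHom_trivLift adj h (tangent_preservesPowers adj h X A.X) rfl).comm

end TangentStructure

end TangentCat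

end
noncomputable section

set_option linter.unusedSectionVars false

namespace TangentCat

/-! ### Every differential bundle is trivial -/

section DifferentialBundles

variable {C : Type u} [Category.{v} C] [CartesianMonoidalCategory C] [HasZeroMorphisms C]
  [HasFiniteColimits C] [StronglyUnital C] [Regular C] [BraidedCategory C]
  {Ab : C ⥤ CommGrp C} (adj : Ab ⊣ CommGrp.forget C)

theorem tensorHom_trivLift {X X' A A' : C} (g : X ⟶ X') (f : A ⟶ A') :
    (g ⊗ₘ f) ≫ trivLift adj X' A' =
      trivLift adj X A ≫ ((g ⊗ₘ f) ⊗ₘ (underlying Ab).map (g ⊗ₘ f)) := by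
  refine CartesianMonoidalCategory.hom_ext _ _ ?_ ?_
  · rw [Category.assoc, Category.assoc, trivLift_fst, tensorHom_fst, tensorHom_fst_assoc,
      trivLift_fst_assoc, inl_tensorHom]
  · rw [Category.assoc, Category.assoc, trivLift_snd, tensorHom_snd, tensorHom_snd_assoc,
      trivLift_snd_assoc, etaL_map, inr_tensorHom_assoc]

/-- Morphisms of trivial bundles which commute with the lifts are products of morphisms. -/
theorem eq_tensorHom_of_linear {X X' : C} {A A' : CommGrp C} {f : X ⊗ A.X ⟶ X' ⊗ A'.X}
    {g : X ⟶ X'} (hf : f ≫ fst _ _ = fst _ _ ≫ g)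
    (hl : f ≫ trivLift adj X' A'.X = trivLift adj X A.X ≫ (f ⊗ₘ (underlying Ab).map f)) :
    f = g ⊗ₘ (inr X A.X ≫ f ≫ snd _ _) := by
  refine CartesianMonoidalCategory.hom_ext _ _ ?_ ?_
  · rw [hf, tensorHom_fst]
  -- The last coordinate of linearity says that the fibre component of `f` at (x, a) agrees with its
  -- value at (0, a) after applying η, which is invertible at `A'`.
  · have := hl =≫ (snd _ _ ≫ (underlying Ab).map (snd _ _))
    rw [Category.assoc, Category.assoc, trivLift_snd_map_snd, tensorHom_snd_assoc,
      trivLift_snd_assoc, etaL_map_assoc, etaL_map] at this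
    rw [tensorHom_snd, ← cancel_mono (etaL adj A'.X)]
    simpa only [Category.assoc] using this

variable {h : IsAdditiveAssignment Ab (abNu adj)} {X : C}

section

variable (B : BundleData X) (hB : PreservesPowers h.tangentData.T B.q)

-- The hypothesis concerns T rather than L; padding with zero in the base factor isolates the
-- statement about L.
include hB in
theorem underlying_pullback_hom_ext {Z : C} {f g : Z ⟶ (underlying Ab).obj B.E₂}
    (h₁ : f ≫ (underlying Ab).map B.ρ₁ = g ≫ (underlying Ab).map B.ρ₁)
    (h₂ : f ≫ (underlying Ab).map B.ρ₂ = g ≫ (underlying Ab).map B.ρ₂) : f = g := by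
  have e {ρ : B.E₂ ⟶ B.E} (e' : f ≫ (underlying Ab).map ρ = g ≫ (underlying Ab).map ρ) :
      lift (0 : Z ⟶ B.E₂) f ≫ (ρ ⊗ₘ (underlying Ab).map ρ) =
        lift (0 : Z ⟶ B.E₂) g ≫ (ρ ⊗ₘ (underlying Ab).map ρ) := by
    rw [lift_map, lift_map, e']
  have key : lift (0 : Z ⟶ B.E₂) f = lift (0 : Z ⟶ B.E₂) g :=
    (B.map h.tangentData.T hB).isPullback.hom_ext (e h₁) (e h₂)
  simpa using key =≫ snd _ _

/-- The components of `T(σ) ∘ ⟨λ ∘ ρ₁, z ∘ ρ₂⟩` for a lift of an additive bundle. -/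
theorem liftSum_eq (hA : B.IsAdditive) {lam : B.E ⟶ B.E ⊗ (underlying Ab).obj B.E}
    (h₁ : lam ≫ fst _ _ = B.q ≫ B.zero)
    (h₂ : lam ≫ (B.q ⊗ₘ (underlying Ab).map B.q) = B.q ≫ h.tangentData.z.app X) :
    h.tangentData.liftSum B hB lam h₂ = lift B.ρ₂ (B.ρ₁ ≫ lam ≫ snd _ _) := by
  obtain ⟨w, hw₁, hw₂, hw⟩ : ∃ w : B.E₂ ⟶ B.E₂ ⊗ (underlying Ab).obj B.E₂,
      w ≫ (B.ρ₁ ⊗ₘ (underlying Ab).map B.ρ₁) = B.ρ₁ ≫ lam ∧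
      w ≫ (B.ρ₂ ⊗ₘ (underlying Ab).map B.ρ₂) = B.ρ₂ ≫ inl B.E _ ∧
      h.tangentData.liftSum B hB lam h₂ = w ≫ (B.sum ⊗ₘ (underlying Ab).map B.sum) :=
    ⟨_, IsPullback.lift_fst _ _ _ _,
      (IsPullback.lift_snd _ _ _ _).trans (B.ρ₂ ≫= tangent_z_app adj h B.E), rfl⟩
  have h₂' : lam ≫ snd _ _ ≫ (underlying Ab).map B.q = 0 := by
    have e : lam ≫ (B.q ⊗ₘ (underlying Ab).map B.q) = B.q ≫ inl X _ :=
      h₂.trans (B.q ≫= tangent_z_app adj h X)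
    simpa using e =≫ snd _ _
  -- In its base component the pairing has a zero vector on the left, and in its tangent component
  -- it has zero on the right. The two unit laws of the bundle then remove the sum, with no
  -- trivialization needed.
  have hp₁ : w ≫ fst _ _ = B.ρ₂ ≫ B.pair (B.q ≫ B.zero) (𝟙 B.E)
      (by rw [Category.assoc, hA.zero_q, Category.comp_id, Category.id_comp]) := by
    apply B.isPullback.hom_ext
    · have := hw₁ =≫ fst _ _
      rw [Category.assoc, Category.assoc, tensorHom_fst, h₁] at this
      rw [Category.assoc, this, Category.assoc, BundleData.pair, IsPullback.lift_fst,
        B.isPullback.w_assoc]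
    · have := hw₂ =≫ fst _ _
      rw [Category.assoc, Category.assoc, tensorHom_fst, inl_fst] at this
      rw [Category.assoc, this, Category.assoc, BundleData.pair, IsPullback.lift_snd]
  have hp₂ : w ≫ snd _ _ = B.ρ₁ ≫ lam ≫ snd _ _ ≫ (underlying Ab).map
      (B.pair (𝟙 B.E) (B.q ≫ B.zero)
        (by rw [Category.assoc, hA.zero_q, Category.comp_id, Category.id_comp])) := by
    apply underlying_pullback_hom_ext adj B hB
    · have := hw₁ =≫ snd _ _
      rw [Category.assoc, Category.assoc, tensorHom_snd] at this
      rw [Category.assoc, this]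
      simp only [Category.assoc, ← Functor.map_comp]
      rw [BundleData.pair, IsPullback.lift_fst, CategoryTheory.Functor.map_id, Category.comp_id]
    · have := hw₂ =≫ snd _ _
      rw [Category.assoc, Category.assoc, tensorHom_snd, inl_snd, comp_zero] at this
      rw [Category.assoc, this]
      simp only [Category.assoc, ← Functor.map_comp]
      rw [BundleData.pair, IsPullback.lift_snd, Functor.map_comp, reassoc_of% h₂', zero_comp,
        comp_zero]
  rw [hw]
  refine CartesianMonoidalCategory.hom_ext _ _ ?_ ?_
  · rw [Category.assoc, tensorHom_fst, reassoc_of% hp₁, hA.zero_sum, Category.comp_id, lift_fst]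
  · rw [Category.assoc, tensorHom_snd, reassoc_of% hp₂, ← Functor.map_comp, hA.sum_zero,
      CategoryTheory.Functor.map_id, Category.comp_id, lift_snd]

end

namespace DiffBundle

variable {adj}

variable (B : DiffBundle h.tangentData.toTangentData X)

/-- The component `E ⟶ L E` of the lift of a differential bundle. -/
def lamSnd : B.E ⟶ (underlying Ab).obj B.E :=
  (show B.E ⟶ B.E ⊗ (underlying Ab).obj B.E from B.lam) ≫ snd _ _

theorem lam_eq : B.lam = lift (B.q ≫ B.zero) B.lamSnd := by
  refine Eq.trans (CartesianMonoidalCategory.hom_ext (Y := (underlying Ab).obj B.E) _ _ ?_ ?_) rfl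
  · exact B.lam_additive.comm.trans (lift_fst _ _).symm
  · exact (lift_snd (B.q ≫ B.zero) B.lamSnd).symm

theorem lamSnd_map_q : B.lamSnd ≫ (underlying Ab).map B.q = 0 := by
  have e : lift (B.q ≫ B.zero) B.lamSnd ≫ (B.q ⊗ₘ (underlying Ab).map B.q) = B.q ≫ inl X _ :=
    (B.lam_eq =≫ h.tangentData.T.map B.q).symm.trans
      (B.lam_additive_zero.comm.trans (B.q ≫= tangent_z_app adj h X))
  simpa using e =≫ snd _ _

theorem zero_lamSnd : B.zero ≫ B.lamSnd = 0 := by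
  have e : B.zero ≫ lift (B.q ≫ B.zero) B.lamSnd = B.zero ≫ inl B.E _ :=
    (B.zero ≫= B.lam_eq).symm.trans
      (B.lam_additive.zero.trans (B.zero ≫= tangent_z_app adj h B.E))
  simpa using e =≫ snd _ _

/-- The innermost tangent coordinate of the axiom T(λ)λ = ℓλ, where the vertical lift contributes η.
-/
theorem lamSnd_map_lamSnd :
    B.lamSnd ≫ (underlying Ab).map B.lamSnd = B.lamSnd ≫ etaL adj _ := by
  have e : lift (B.q ≫ B.zero) B.lamSnd ≫ (lift (B.q ≫ B.zero) B.lamSnd ⊗ₘ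
      (underlying Ab).map (lift (B.q ≫ B.zero) B.lamSnd)) =
        lift (B.q ≫ B.zero) B.lamSnd ≫ trivLift adj B.E _ := by
    have := B.lam_lam
    rw [tangent_l_app, lam_eq] at this
    exact this
  have := e =≫ (snd _ _ ≫ (underlying Ab).map (snd _ _))
  simp only [Category.assoc, tensorHom_snd_assoc, lift_snd_assoc, ← Functor.map_comp, lift_snd,
    trivLift_snd_map_snd] at this
  exact this

/-- The fibre of a differential bundle: the kernel of `L q`. -/
def fibreObj : C := kernel ((underlying Ab).map B.q)

/-- The inclusion of the fibre. -/
def fibreι : B.fibreObj ⟶ (underlying Ab).obj B.E := kernel.ι ((underlying Ab).map B.q)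

instance : Mono B.fibreι := inferInstanceAs (Mono (kernel.ι _))

theorem fibreι_map_q : B.fibreι ≫ (underlying Ab).map B.q = 0 := kernel.condition _

/-- The universal property of the fibre. -/
def fibreLift {Z : C} (f : Z ⟶ (underlying Ab).obj B.E)
    (hf : f ≫ (underlying Ab).map B.q = 0) : Z ⟶ B.fibreObj :=
  kernel.lift _ f hf

theorem fibreLift_fibreι {Z : C} (f : Z ⟶ (underlying Ab).obj B.E)
    (hf : f ≫ (underlying Ab).map B.q = 0) : B.fibreLift f hf ≫ B.fibreι = f :=
  kernel.lift_ι _ _ _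

/-- The addition on the fibre. -/
def fibreMul : UnitalMul B.fibreObj where
  mul := B.fibreLift ((B.fibreι ⊗ₘ B.fibreι) ≫ μ[(underlying Ab).obj B.E]) (by
    rw [Category.assoc, IsMonHom.mul_hom ((underlying Ab).map B.q), tensorHom_comp_tensorHom_assoc, fibreι_map_q]
    apply prod_hom_ext
    · rw [inl_tensorHom_assoc, zero_comp, comp_zero]
    · rw [inr_tensorHom_assoc, zero_comp, comp_zero])
  inl_mul := by
    rw [← cancel_mono B.fibreι, Category.assoc, fibreLift_fibreι, inl_tensorHom_assoc, inl_mul,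
      Category.comp_id, Category.id_comp]
  inr_mul := by
    rw [← cancel_mono B.fibreι, Category.assoc, fibreLift_fibreι, inr_tensorHom_assoc, inr_mul,
      Category.comp_id, Category.id_comp]

/-- The fibre of a differential bundle as an abelian group object. -/
def fibre : CommGrp C := B.fibreMul.toCommGrp

/-- The component of the trivialization to the fibre. -/
def toFibre : B.E ⟶ B.fibreObj := B.fibreLift B.lamSnd B.lamSnd_map_q

theorem toFibre_fibreι : B.toFibre ≫ B.fibreι = B.lamSnd := B.fibreLift_fibreι _ _

theorem isIso_etaL_fibreObj : IsIso (etaL adj B.fibreObj) := isIso_etaL adj B.fibre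

/-- Preservation of monomorphisms by L is not needed: source and target of the inclusion are abelian
group objects, so η is invertible at both and conjugates the inclusion into its image under L. -/
theorem mono_map_fibreι : Mono ((underlying Ab).map B.fibreι) := by
  have := isIso_etaL_fibreObj B
  have h₁ : IsIso (etaL adj ((underlying Ab).obj B.E)) := isIso_etaL adj (Ab.obj B.E)
  have : (underlying Ab).map B.fibreι = inv (etaL adj B.fibreObj) ≫ B.fibreι ≫ etaL adj _ := by
    rw [IsIso.eq_inv_comp, etaL_map]
  rw [this]
  infer_instance

theorem lamSnd_map_toFibre :
    B.lamSnd ≫ (underlying Ab).map B.toFibre = B.toFibre ≫ etaL adj B.fibreObj := by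
  have := mono_map_fibreι B
  rw [← cancel_mono ((underlying Ab).map B.fibreι), Category.assoc, ← Functor.map_comp,
    toFibre_fibreι, lamSnd_map_lamSnd, Category.assoc, etaL_map, reassoc_of% B.toFibre_fibreι]

/-- The trivialization of a differential bundle. -/
def triv : B.E ⟶ X ⊗ B.fibreObj := lift B.q B.toFibre

/-- The four coordinates correspond to the zero being a section, to the lift vanishing on the zero
section, to the lift being vertical, and to linearity of the fibre component (`lamSnd_map_toFibre`).
-/
theorem triv_linear : B.triv ≫ trivLift adj X B.fibreObj =
    lift (B.q ≫ B.zero) B.lamSnd ≫ (B.triv ⊗ₘ (underlying Ab).map B.triv) := by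
  apply tangent_hom_ext adj
  · simp [triv, B.additive.zero_q]
  · have : B.zero ≫ B.toFibre = 0 := by
      rw [← cancel_mono B.fibreι, Category.assoc, toFibre_fibreι, zero_lamSnd, zero_comp]
    simp [triv, this]
  · simp only [Category.assoc, trivLift_snd_map_fst, tensorHom_snd_assoc, lift_snd_assoc,
      ← Functor.map_comp, comp_zero]
    rw [triv, lift_fst, lamSnd_map_q]
  · simp only [Category.assoc, trivLift_snd_map_snd, tensorHom_snd_assoc, lift_snd_assoc,
      ← Functor.map_comp]
    rw [triv, lift_snd, lift_snd_assoc, lamSnd_map_toFibre]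

theorem liftSum_eq_lift :
    h.tangentData.liftSum B.toBundleData (B.preserves 1).of_iter_one B.lam
      B.lam_additive_zero.comm = lift B.ρ₂ (B.ρ₁ ≫ B.lamSnd) :=
  liftSum_eq adj B.toBundleData (B.preserves 1).of_iter_one B.additive B.lam_additive.comm
    B.lam_additive_zero.comm

instance isIso_triv : IsIso B.triv := by
  have hP : IsPullback (lift B.ρ₂ (B.ρ₁ ≫ B.lamSnd)) (B.ρ₁ ≫ B.q)
      (B.q ⊗ₘ (underlying Ab).map B.q) (inl X ((underlying Ab).obj X)) := by
    have := B.universal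
    rw [liftSum_eq_lift, tangent_z_app] at this
    exact this
  -- For x in X and k in the kernel of L(q), the tangent vector k at the zero of the fibre over x is
  -- sent by T(q) to the zero vector at x. Universality gives a pair in E₂ whose second entry is
  -- that zero and whose first entry lies over x and lifts to k; the first entry is the inverse of
  -- the trivialization.
  let u : X ⊗ B.fibreObj ⟶ B.E₂ :=
    hP.lift (lift (fst _ _ ≫ B.zero) (snd _ _ ≫ B.fibreι)) (fst _ _) (by
      ext
      · simp [B.additive.zero_q]
      · simp [fibreι_map_q])
  have u₁ : u ≫ lift B.ρ₂ (B.ρ₁ ≫ B.lamSnd) = lift (fst _ _ ≫ B.zero) (snd _ _ ≫ B.fibreι) :=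
    hP.lift_fst _ _ _
  have u₂ : u ≫ B.ρ₁ ≫ B.q = fst _ _ := hP.lift_snd _ _ _
  have u₃ : u ≫ B.ρ₁ ≫ B.lamSnd = snd _ _ ≫ B.fibreι := by
    simpa using u₁ =≫ snd _ _
  have hv : B.triv ≫ u = B.pair (𝟙 B.E) (B.q ≫ B.zero)
      (by rw [Category.assoc, B.additive.zero_q, Category.comp_id, Category.id_comp]) := by
    apply hP.hom_ext
    · rw [Category.assoc, u₁]
      ext
      · simp [triv, BundleData.pair]
      · simp [triv, BundleData.pair, toFibre_fibreι]
    · rw [Category.assoc, u₂]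
      simp [triv, BundleData.pair]
  refine ⟨u ≫ B.ρ₁, ?_, ?_⟩
  · rw [← Category.assoc, hv, BundleData.pair, IsPullback.lift_fst]
  · ext
    · simp [triv, u₂]
    · rw [← cancel_mono B.fibreι]
      simp [triv, toFibre_fibreι, u₃]

end DiffBundle

end DifferentialBundles

end TangentCat

end
noncomputable section

set_option linter.unusedSectionVars false

namespace TangentCat

/-! ### Equivalences with categories of abelian group objects -/

section Equivalences

variable {C : Type u} [Category.{v} C]

theorem inv_linear {D : TangentData C} {E E' : C} {lam : E ⟶ D.T.obj E}
    {lam' : E' ⟶ D.T.obj E'} (f : E ⟶ E') [IsIso f] (hf : f ≫ lam' = lam ≫ D.T.map f) :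
    inv f ≫ lam = lam' ≫ D.T.map (inv f) := by
  rw [IsIso.inv_comp_eq, ← Category.assoc, hf, Category.assoc, ← D.T.map_comp,
    IsIso.hom_inv_id, D.T.map_id, Category.comp_id]

/-- An invertible linear bundle morphism is an isomorphism of differential bundles. -/
def diffBundleIso {D : TangentData C} {X : C} {A B : DiffBundle D X} (φ : DiffBundle.Hom A B)
    [IsIso φ.f] : A ≅ B where
  hom := φ
  inv := ⟨inv φ.f, by rw [IsIso.inv_comp_eq, φ.comm], inv_linear φ.f φ.linear⟩
  hom_inv_id := DiffBundle.Hom.ext (IsIso.hom_inv_id φ.f)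
  inv_hom_id := DiffBundle.Hom.ext (IsIso.inv_hom_id φ.f)

/-- Differential bundles over `X` as differential bundles over some object. -/
def toDBun (D : TangentData C) (X : C) : DiffBundle D X ⥤ DBun D where
  obj B := ⟨X, B⟩
  map φ := ⟨φ.f, 𝟙 X, φ.comm.trans (Category.comp_id _).symm, φ.linear⟩
  map_comp _ _ := DBun.Hom.ext rfl (Category.comp_id _).symm

variable [CartesianMonoidalCategory C] [HasZeroMorphisms C]
  [HasFiniteColimits C] [StronglyUnital C] [Regular C] [BraidedCategory C]
  {Ab : C ⥤ CommGrp C} (adj : Ab ⊣ CommGrp.forget C) (h : IsAdditiveAssignment Ab (abNu adj))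

/-- The trivialization of a differential bundle is an isomorphism of differential bundles. -/
def trivIso {X : C} (B : DiffBundle h.tangentData.toTangentData X) :
    B ≅ trivBundle adj h X B.fibre :=
  haveI : IsIso (X := B.E) (Y := (trivBundle adj h X B.fibre).E) B.triv := B.isIso_triv
  diffBundleIso (A := B) (B := trivBundle adj h X B.fibre)
    { f := B.triv
      comm := lift_fst _ _
      linear := B.triv_linear.trans (B.lam_eq =≫ h.tangentData.T.map B.triv).symm }

/-- The functor assigning trivial bundles over `X` to abelian group objects. -/
def trivFunctor (X : C) : CommGrp C ⥤ DiffBundle h.tangentData.toTangentData X where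
  obj A := trivBundle adj h X A
  map f :=
    { f := 𝟙 X ⊗ₘ f.hom.hom.hom
      comm := (tensorHom_fst _ _).trans (Category.comp_id _)
      linear := tensorHom_trivLift adj _ _ }
  map_id _ := DiffBundle.Hom.ext (id_tensorHom_id _ _)
  map_comp f g := DiffBundle.Hom.ext <| by
    have e : (𝟙 X ⊗ₘ (f.hom.hom.hom ≫ g.hom.hom.hom)) =
        (𝟙 X ⊗ₘ f.hom.hom.hom) ≫ (𝟙 X ⊗ₘ g.hom.hom.hom) := by
      rw [tensorHom_comp_tensorHom, Category.comp_id]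
    exact e

/-- The functor assigning trivial bundles to pairs of an object and an abelian group object. -/
def trivDBunFunctor : C × CommGrp C ⥤ DBun h.tangentData.toTangentData where
  obj P := ⟨P.1, trivBundle adj h P.1 P.2⟩
  map f :=
    { f := f.1 ⊗ₘ f.2.hom.hom.hom
      g := f.1
      comm := tensorHom_fst _ _
      linear := tensorHom_trivLift adj _ _ }
  map_id _ := DBun.Hom.ext (id_tensorHom_id _ _) rfl
  map_comp _ _ := DBun.Hom.ext (tensorHom_comp_tensorHom _ _ _ _).symm rfl

theorem hom_ext_of_tensorHom_eq {X X' A A' : C} {g : X ⟶ X'} {f f' : A ⟶ A'}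
    (e : (g ⊗ₘ f) = g ⊗ₘ f') : f = f' := by
  have := inr X A ≫= e =≫ snd _ _
  simpa [inr_tensorHom] using this

instance (X : C) : (trivFunctor adj h X).Faithful where
  map_injective e := CommGrp.hom_ext _ _ (hom_ext_of_tensorHom_eq (congrArg DiffBundle.Hom.f e))

instance : (trivDBunFunctor adj h).Faithful where
  map_injective {P Q f f'} e := by
    have e₁ : f.1 = f'.1 := congrArg DBun.Hom.g e
    refine Prod.ext e₁ (CommGrp.hom_ext _ _ (hom_ext_of_tensorHom_eq (g := f.1) ?_))
    exact (congrArg DBun.Hom.f e).trans (by rw [e₁]; rfl)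

/-- Linearity yields only a morphism between the fibres; it is a homomorphism because every morphism
between abelian group objects is one. -/
instance (X : C) : (trivFunctor adj h X).Full where
  map_surjective {A A'} φ := by
    have e := eq_tensorHom_of_linear adj (X := X) (X' := X) (A := A) (A' := A') (f := φ.f)
      (g := 𝟙 X) (φ.comm.trans (Category.comp_id _).symm) φ.linear
    exact ⟨commGrpHom _, DiffBundle.Hom.ext e.symm⟩

instance : (trivDBunFunctor adj h).Full where
  map_surjective {P P'} φ := by
    have e := eq_tensorHom_of_linear adj (X := P.1) (X' := P'.1) (A := P.2) (A' := P'.2)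
      (f := φ.f) (g := φ.g) φ.comm φ.linear
    exact ⟨(φ.g, commGrpHom _), DBun.Hom.ext e.symm rfl⟩

instance (X : C) : (trivFunctor adj h X).EssSurj where
  mem_essImage B := ⟨B.fibre, ⟨(trivIso adj h B).symm⟩⟩

instance : (trivDBunFunctor adj h).EssSurj where
  mem_essImage B := ⟨(B.base, B.bundle.fibre),
    ⟨((toDBun _ B.base).mapIso (trivIso adj h B.bundle)).symm⟩⟩

instance (X : C) : (trivFunctor adj h X).IsEquivalence where

instance : (trivDBunFunctor adj h).IsEquivalence where

end Equivalences

end TangentCat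

end

theorem mainTheorem10 {C : Type u} [Category.{v} C] [CartesianMonoidalCategory C]
    [BraidedCategory C] [HasZeroMorphisms C] [HasFiniteColimits C] [Regular C]
    [TangentCat.StronglyUnital C] :
    (CommGrp.forget C).IsRightAdjoint ∧
    ∀ (Ab : C ⥤ CommGrp C) (adj : Ab ⊣ CommGrp.forget C),
      (∀ X : C, ∃ w : TangentCat.quasiInj₁ X ≫ TangentCat.abQuot adj X =
          TangentCat.quasiInj₂ X ≫ TangentCat.abQuot adj X,
        Nonempty (IsColimit (Cofork.ofπ (TangentCat.abQuot adj X) w))) ∧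
      ∃ h : TangentCat.IsAdditiveAssignment Ab (TangentCat.abNu adj),
        h.tangentData.IsCartesianRosicky ∧
        Nonempty (TangentCat.DBun h.tangentData.toTangentData ≌ C × CommGrp C) ∧
        ∀ X : C, Nonempty
          (TangentCat.DiffBundle h.tangentData.toTangentData X ≌ CommGrp C) := by
  refine ⟨TangentCat.forget_isRightAdjoint, fun Ab adj =>
    ⟨fun X => TangentCat.abQuot_isCoequalizer X adj,
      TangentCat.isAdditiveAssignment adj,
      TangentCat.tangentData_isCartesianRosicky adj _, ?_, fun X => ?_⟩⟩
  · exact ⟨(TangentCat.trivDBunFunctor adj _).asEquivalence.symm⟩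
  · exact ⟨(TangentCat.trivFunctor adj _ X).asEquivalence.symm⟩
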